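/- For every integer $n\ge 2$ there is a constant $c_n>0$, depending only on $n$, with the following two properties. Here $D_r=\{z\in\mathbb C:|z|<r\}$, and length means one-dimensional Hausdorff measure. (i) Let $p(z)=z^n+a_2z^{n-2}+a_3z^{n-3}+\dots+a_n$ with $a_2,\dots,a_n\in\mathbb C$, $a_n\in\mathbb R$ and $\max_{2\le k\le n}|a_k|=1$. Then for every $r\ge 2$ the set $\{z\in\mathbb C:\operatorname{Re}p(z)=0\}\cap D_r$ has length at most $2nr-c_n$. (ii) Let $p(z)=z^n+a_2z^{n-2}+a_3z^{n-3}+\dots+a_n$ with $a_2,\dots,a_n\in\mathbb C$, $a_n\in\mathbb R$ and $\max_{2\le k\le n}|a_k|^{1/k}=a>0$. Then for every $r\ge 2a$ the set $\{z\in\mathbb C:\operatorname{Re}p(z)=0\}\cap D_r$ has length at most $2nr-c_n a$. -/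

import Mathlib

open MeasureTheory Polynomial
open scoped ENNReal

/-- The polynomial `z ^ n + a 2 * z ^ (n - 2) + a 3 * z ^ (n - 3) + ⋯ + a n`. Only the values
`a 2, …, a n` of the coefficient sequence are used. -/
noncomputable def centeredPoly (n : ℕ) (a : ℕ → ℂ) : ℂ[X] :=
  X ^ n + ∑ k ∈ Finset.Icc 2 n, C (a k) * X ^ (n - k)

/-- The set of points of the plane at which the real part of `p` vanishes. -/
def reZeroSet (p : ℂ[X]) : Set ℂ := {z : ℂ | (p.eval z).re = 0}

/-- The length of a subset of the plane: its one-dimensional Hausdorff measure with respect to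
the Euclidean distance. -/
noncomputable def planeLength (S : Set ℂ) : ℝ≥0∞ := Measure.hausdorffMeasure 1 S

/-- The set `S` has finite length, and this length is at most the real number `b`. -/
def LengthAtMost (S : Set ℂ) (b : ℝ) : Prop :=
  planeLength S ≠ ⊤ ∧ (planeLength S).toReal ≤ b

open scoped ComplexConjugate
open Filter Topology

/-! ### Restriction of the real part to a line -/

/-! By Cauchy–Crofton, four times the length of a curve is the integral, over normal directions `α`
in `(0, 2π]` and signed distances `d`, of the number of points on the corresponding line. Only the
upper bound for length is needed (`four_mul_hausdorffMeasure_le`). For almost every `α`, `Re p`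
restricts to a real polynomial of exact degree `n`, so there are at most `n` points per line; over
the lines meeting the disc this alone gives `4πnr`. Two savings are made when all `‖a k‖ ≤ 1` and `r
≥ 2`.

The first counts zeros outside the disc. There `p(z) / z ^ n` has positive real part, so the
argument of `p` has a continuous branch along each outer ray of the line, and every odd multiple of
`π / 2` it passes on the way to infinity forces a zero (`exists_zeros_on_ray`). The unknown argument
on the circle contributes equally to both rays after averaging over `α`, hence cancels in their
difference. What remains is at least `4n|arcsin(d / r)|`, with integral `4nr(π - 2)` over `d`. Since
`4πnr - 4nr(π - 2) = 8nr`, the length is at most `2nr`.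

The second is the constant. A line on which the polynomial has a nonreal root loses one more zero.
If no line through the origin were of this kind, the missing `z ^ (n - 1)` term and Newton's
identity would give the coefficient of `a 2` a definite sign relative to `cos (n * φ)` in each
direction `φ`, while these products average to zero over `n` rotated directions. So all roots would
vanish, and with them all `a k` (`exists_lineDefective`). Defectiveness is an open condition and
normalised coefficients form a compact set, so defective lines have measure bounded below. Part (ii)
follows by scaling. -/

theorem eval_centeredPoly (n : ℕ) (a : ℕ → ℂ) (z : ℂ) :
    (centeredPoly n a).eval z = z ^ n + ∑ k ∈ Finset.Icc 2 n, a k * z ^ (n - k) := by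
  simp [centeredPoly, eval_finsetSum]

theorem degree_centeredPoly_tail_lt {n : ℕ} (hn : 2 ≤ n) (a : ℕ → ℂ) :
    (∑ k ∈ Finset.Icc 2 n, C (a k) * X ^ (n - k)).degree < (n : WithBot ℕ) := by
  refine (degree_sum_le _ _).trans_lt ?_
  rw [Finset.sup_lt_iff (by exact_mod_cast WithBot.bot_lt_coe n)]
  intro k hk
  rw [Finset.mem_Icc] at hk
  refine (degree_C_mul_X_pow_le _ _).trans_lt ?_
  exact_mod_cast (by omega : n - k < n)

theorem centeredPoly_monic {n : ℕ} (hn : 2 ≤ n) (a : ℕ → ℂ) : (centeredPoly n a).Monic :=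
  monic_X_pow_add (degree_centeredPoly_tail_lt hn a)

theorem natDegree_centeredPoly {n : ℕ} (hn : 2 ≤ n) (a : ℕ → ℂ) :
    (centeredPoly n a).natDegree = n := by
  rw [centeredPoly, natDegree_add_eq_left_of_degree_lt, natDegree_X_pow]
  rw [degree_X_pow]
  exact degree_centeredPoly_tail_lt hn a

/-- The point with parameter `w` on the line with unit normal `exp (α * I)` at signed distance `d`
from the origin. -/
noncomputable def linePoint (α d : ℝ) (w : ℂ) : ℂ :=
  Complex.exp (α * Complex.I) * (d + Complex.I * w)

/-- The polynomial in the parameter of a line that extends the restriction of `Re p`. -/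
noncomputable def linePoly (n : ℕ) (a : ℕ → ℂ) (α d : ℝ) : ℂ[X] :=
  C (1 / 2) * ((centeredPoly n a).comp (C (Complex.exp (α * Complex.I)) * (C (d : ℂ) + C Complex.I * X)) +
    ((centeredPoly n a).comp (C (Complex.exp (α * Complex.I)) *
      (C (d : ℂ) + C Complex.I * X))).map (starRingEnd ℂ))

theorem eval_linePoly (n : ℕ) (a : ℕ → ℂ) (α d : ℝ) (w : ℂ) :
    (linePoly n a α d).eval w = 1 / 2 * ((centeredPoly n a).eval (linePoint α d w) +
      conj ((centeredPoly n a).eval (linePoint α d (conj w)))) := by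
  have h := eval_map_apply (p := (centeredPoly n a).comp (C (Complex.exp (α * Complex.I)) *
      (C (d : ℂ) + C Complex.I * X))) (starRingEnd ℂ) (conj w)
  rw [Complex.conj_conj] at h
  rw [linePoly, eval_mul, eval_add, h]
  simp [eval_comp, linePoint]

theorem eval_linePoly_ofReal (n : ℕ) (a : ℕ → ℂ) (α d t : ℝ) :
    (linePoly n a α d).eval (t : ℂ) =
      (((centeredPoly n a).eval (linePoint α d t)).re : ℂ) := by
  rw [eval_linePoly, Complex.conj_ofReal, Complex.add_conj]
  push_cast
  ring

theorem natDegree_line_factor (α d : ℝ) :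
    (C (Complex.exp (α * Complex.I)) * (C (d : ℂ) + C Complex.I * X)).natDegree = 1 := by
  rw [natDegree_C_mul (Complex.exp_ne_zero _), add_comm]
  exact natDegree_linear Complex.I_ne_zero

theorem coeff_linePoly {n : ℕ} (hn : 2 ≤ n) (a : ℕ → ℂ) (α d : ℝ) :
    (linePoly n a α d).coeff n = (Real.cos (n * (α + Real.pi / 2)) : ℂ) := by
  have hd := natDegree_line_factor α d
  set q := C (Complex.exp (α * Complex.I)) * (C (d : ℂ) + C Complex.I * X) with hq
  have hl : q.leadingCoeff = Complex.exp (α * Complex.I) * Complex.I := by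
    rw [hq, leadingCoeff_mul, leadingCoeff_C, add_comm, leadingCoeff_linear Complex.I_ne_zero]
  have hc : ((centeredPoly n a).comp q).coeff n =
      Complex.exp ((n * (α + Real.pi / 2) : ℝ) * Complex.I) := by
    have h := leadingCoeff_comp (p := centeredPoly n a) (q := q) (by omega)
    rw [leadingCoeff, natDegree_comp, hd, natDegree_centeredPoly hn, mul_one,
      (centeredPoly_monic hn a).leadingCoeff, one_mul, hl] at h
    rw [h]
    nth_rewrite 2 [← Complex.exp_pi_div_two_mul_I]
    rw [← Complex.exp_add, ← Complex.exp_nat_mul]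
    congr 1
    push_cast
    ring
  rw [linePoly, coeff_C_mul, coeff_add, coeff_map, hc, Complex.add_conj,
    Complex.exp_ofReal_mul_I_re]
  push_cast
  ring

theorem natDegree_linePoly_le {n : ℕ} (hn : 2 ≤ n) (a : ℕ → ℂ) (α d : ℝ) :
    (linePoly n a α d).natDegree ≤ n := by
  have h : ((centeredPoly n a).comp (C (Complex.exp (α * Complex.I)) *
      (C (d : ℂ) + C Complex.I * X))).natDegree = n := by
    rw [natDegree_comp, natDegree_line_factor, natDegree_centeredPoly hn, mul_one]
  refine (natDegree_C_mul_le _ _).trans ((natDegree_add_le _ _).trans (max_le h.le ?_))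
  exact natDegree_map_le.trans h.le

theorem natDegree_linePoly {n : ℕ} (hn : 2 ≤ n) (a : ℕ → ℂ) {α : ℝ} (d : ℝ)
    (hα : Real.cos (n * (α + Real.pi / 2)) ≠ 0) : (linePoly n a α d).natDegree = n := by
  refine le_antisymm (natDegree_linePoly_le hn a α d) (le_natDegree_of_ne_zero ?_)
  rw [coeff_linePoly hn]
  exact_mod_cast hα

theorem linePoly_eq_prod {n : ℕ} (hn : 2 ≤ n) (a : ℕ → ℂ) {α : ℝ} (d : ℝ)
    (hα : Real.cos (n * (α + Real.pi / 2)) ≠ 0) :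
    linePoly n a α d = C (Real.cos (n * (α + Real.pi / 2)) : ℂ) *
      ((linePoly n a α d).roots.map (fun t => X - C t)).prod := by
  have h := C_leadingCoeff_mul_prod_multiset_X_sub_C
    (IsAlgClosed.card_roots_eq_natDegree (p := linePoly n a α d))
  rw [leadingCoeff, natDegree_linePoly hn a d hα, coeff_linePoly hn] at h
  exact h.symm

/-- A line is defective if the line polynomial takes a value that is too small for a polynomial
with only real roots. -/
def lineDefective (n : ℕ) (a : ℕ → ℂ) (α d : ℝ) : Prop :=
  ∃ w : ℂ, ‖(linePoly n a α d).eval w‖ < |Real.cos (n * (α + Real.pi / 2))| * |w.im| ^ n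

theorem cos_ne_zero_of_lineDefective {n : ℕ} {a : ℕ → ℂ} {α d : ℝ} (h : lineDefective n a α d) :
    Real.cos (n * (α + Real.pi / 2)) ≠ 0 := by
  rintro h0
  obtain ⟨w, hw⟩ := h
  rw [h0, abs_zero, zero_mul] at hw
  exact (norm_nonneg _).not_gt hw

/-- A real `t` is at distance at least `|w.im|` from `w`. This bound turns the presence of a nonreal
root into the strict inequality of `lineDefective`, which is visibly open in the coefficients and
the line. -/
theorem abs_im_pow_card_le_norm_prod (s : Multiset ℂ) (hs : ∀ t ∈ s, t.im = 0) (w : ℂ) :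
    |w.im| ^ s.card ≤ ‖(s.map (fun t => w - t)).prod‖ := by
  induction s using Multiset.induction with
  | empty => simp
  | cons t s ih =>
    rw [Multiset.card_cons, pow_succ', Multiset.map_cons, Multiset.prod_cons, norm_mul]
    have h1 : |w.im| ≤ ‖w - t‖ := by
      have := Complex.abs_im_le_norm (w - t)
      rwa [Complex.sub_im, hs t (Multiset.mem_cons_self t s), sub_zero] at this
    exact mul_le_mul h1 (ih fun x hx => hs x (Multiset.mem_cons_of_mem hx)) (by positivity)
      (norm_nonneg _)

theorem exists_root_im_ne_zero {n : ℕ} (hn : 2 ≤ n) {a : ℕ → ℂ} {α d : ℝ}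
    (h : lineDefective n a α d) : ∃ t ∈ (linePoly n a α d).roots, t.im ≠ 0 := by
  by_contra! hcon
  have hα := cos_ne_zero_of_lineDefective h
  obtain ⟨w, hw⟩ := h
  have h1 := abs_im_pow_card_le_norm_prod _ hcon w
  rw [IsAlgClosed.card_roots_eq_natDegree, natDegree_linePoly hn a d hα] at h1
  rw [linePoly_eq_prod hn a d hα, eval_C_mul, eval_multiset_prod, Multiset.map_map, norm_mul,
    Complex.norm_real, Real.norm_eq_abs] at hw
  simp only [Function.comp_def, eval_sub, eval_X, eval_C] at hw
  exact absurd (lt_of_mul_lt_mul_left hw (abs_nonneg _)) h1.not_gt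

theorem lineDefective_of_root {n : ℕ} {a : ℕ → ℂ} {α d : ℝ}
    (hα : Real.cos (n * (α + Real.pi / 2)) ≠ 0) {t : ℂ} (ht : t ∈ (linePoly n a α d).roots)
    (h : t.im ≠ 0) : lineDefective n a α d := by
  refine ⟨t, ?_⟩
  rw [(mem_roots'.1 ht).2.eq_zero, norm_zero]
  positivity

open Classical in
/-- The real zeros of `Re p` on a line number at most `n`, and fewer on a defective line. -/
theorem card_le_of_line_zeros {n : ℕ} (hn : 2 ≤ n) (a : ℕ → ℂ) {α : ℝ} (d : ℝ)
    (hα : Real.cos (n * (α + Real.pi / 2)) ≠ 0) (T : Finset ℝ)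
    (hT : ∀ t ∈ T, ((centeredPoly n a).eval (linePoint α d t)).re = 0) :
    T.card + (if lineDefective n a α d then 1 else 0) ≤ n := by
  have h0 : linePoly n a α d ≠ 0 := by
    intro h
    have := natDegree_linePoly hn a d hα
    rw [h, natDegree_zero] at this
    omega
  have hmem : ∀ t ∈ T, (t : ℂ) ∈ (linePoly n a α d).roots.toFinset := by
    intro t ht
    rw [Multiset.mem_toFinset, mem_roots h0, IsRoot, eval_linePoly_ofReal, hT t ht,
      Complex.ofReal_zero]
  have hsub : T.image (fun t : ℝ => (t : ℂ)) ⊆ (linePoly n a α d).roots.toFinset := by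
    intro z hz
    obtain ⟨t, ht, rfl⟩ := Finset.mem_image.1 hz
    exact hmem t ht
  have hcard : (T.image (fun t : ℝ => (t : ℂ))).card = T.card :=
    Finset.card_image_of_injective _ Complex.ofReal_injective
  have hroots : (linePoly n a α d).roots.toFinset.card ≤ n :=
    (Multiset.toFinset_card_le _).trans
      ((card_roots' _).trans (natDegree_linePoly_le hn a α d))
  split_ifs with hb
  · obtain ⟨z, hz, hzim⟩ := exists_root_im_ne_zero hn hb
    have hss : T.image (fun t : ℝ => (t : ℂ)) ⊂ (linePoly n a α d).roots.toFinset := by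
      refine (Finset.ssubset_iff_of_subset hsub).2 ⟨z, Multiset.mem_toFinset.2 hz, ?_⟩
      intro hz'
      obtain ⟨t, _, rfl⟩ := Finset.mem_image.1 hz'
      exact hzim (Complex.ofReal_im t)
    have := Finset.card_lt_card hss
    omega
  · have := Finset.card_le_card hsub
    omega

/-! ### Counting zeros outside a disc -/

/-- The number of zeros of the cosine, signed and normalised, passed on the way from `0` to `x`. -/
noncomputable def crossIndex (x : ℝ) : ℤ := ⌊x / Real.pi + 1 / 2⌋

theorem le_crossIndex_iff (m : ℤ) (x : ℝ) :
    m ≤ crossIndex x ↔ ((m : ℝ) - 1 / 2) * Real.pi ≤ x := by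
  rw [crossIndex, Int.le_floor, ← le_div_iff₀ Real.pi_pos]
  constructor <;> intro h <;> linarith

theorem cos_int_sub_half_mul_pi (m : ℤ) : Real.cos (((m : ℝ) - 1 / 2) * Real.pi) = 0 := by
  rw [Real.cos_eq_zero_iff]
  refine ⟨m - 1, ?_⟩
  push_cast
  ring

/-- Each zero of the cosine lying between `f t₀` and the limit is a value of `f` by the intermediate
value theorem, and distinct values are taken at distinct parameters. -/
theorem exists_finset_cos_eq_zero {f : ℝ → ℝ} {t₀ E : ℝ} (hf : ContinuousOn f (Set.Ici t₀))
    (hE : Tendsto f atTop (𝓝 E)) (hcos : Real.cos E ≠ 0) :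
    ∃ T : Finset ℝ, (∀ t ∈ T, t₀ ≤ t ∧ Real.cos (f t) = 0) ∧
      T.card = (crossIndex E - crossIndex (f t₀)).natAbs := by
  classical
  -- One of the two intervals is empty, depending on the direction of the net change.
  set S := Finset.Ioc (crossIndex (f t₀)) (crossIndex E) ∪
    Finset.Ioc (crossIndex E) (crossIndex (f t₀)) with hS
  have hl : (atTop : Filter ℝ) ≤ 𝓟 (Set.Ici t₀) := le_principal_iff.2 (Ici_mem_atTop t₀)
  have hval : ∀ m ∈ S, ∃ t, t₀ ≤ t ∧ f t = ((m : ℝ) - 1 / 2) * Real.pi := by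
    intro m hm
    rcases Finset.mem_union.1 hm with h | h
    · obtain ⟨h1, h2⟩ := Finset.mem_Ioc.1 h
      rw [← not_le, le_crossIndex_iff, not_le] at h1
      rw [le_crossIndex_iff] at h2
      -- The limit itself need not be attained, so the level must lie strictly below it.
      have h3 : ((m : ℝ) - 1 / 2) * Real.pi ≠ E := by
        rintro rfl
        exact hcos (cos_int_sub_half_mul_pi m)
      obtain ⟨t, ht, hft⟩ := isPreconnected_Ici.intermediate_value_Ico Set.self_mem_Ici hl hf hE
        ⟨h1.le, lt_of_le_of_ne h2 h3⟩
      exact ⟨t, ht, hft⟩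
    · obtain ⟨h1, h2⟩ := Finset.mem_Ioc.1 h
      rw [← not_le, le_crossIndex_iff, not_le] at h1
      rw [le_crossIndex_iff] at h2
      obtain ⟨t, ht, hft⟩ := isPreconnected_Ici.intermediate_value_Ioc Set.self_mem_Ici hl hf hE
        ⟨h1, h2⟩
      exact ⟨t, ht, hft⟩
  choose! τ hτ using hval
  refine ⟨S.image τ, ?_, ?_⟩
  · intro t ht
    obtain ⟨m, hm, rfl⟩ := Finset.mem_image.1 ht
    rw [(hτ m hm).2]
    exact ⟨(hτ m hm).1, cos_int_sub_half_mul_pi m⟩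
  · rw [Finset.card_image_of_injOn]
    · rcases le_total (crossIndex (f t₀)) (crossIndex E) with h | h
      · rw [hS, Finset.Ioc_eq_empty_of_le h, Finset.union_empty, Int.card_Ioc]
        omega
      · rw [hS, Finset.Ioc_eq_empty_of_le h, Finset.empty_union, Int.card_Ioc]
        omega
    · intro m hm k hk hmk
      have h := (hτ m hm).2.symm.trans ((congrArg f hmk).trans (hτ k hk).2)
      have h' := mul_right_cancel₀ Real.pi_ne_zero h
      exact_mod_cast sub_left_injective h'

/-- The quotient of a centered polynomial by its leading term. -/
noncomputable def leadRatio (n : ℕ) (a : ℕ → ℂ) (z : ℂ) : ℂ :=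
  1 + ∑ k ∈ Finset.Icc 2 n, a k * z⁻¹ ^ k

theorem eval_centeredPoly_eq_mul_leadRatio (n : ℕ) (a : ℕ → ℂ) {z : ℂ} (hz : z ≠ 0) :
    (centeredPoly n a).eval z = z ^ n * leadRatio n a z := by
  rw [eval_centeredPoly, leadRatio, mul_add, mul_one, Finset.mul_sum]
  congr 1
  refine Finset.sum_congr rfl fun k hk => ?_
  have hkn := (Finset.mem_Icc.1 hk).2
  rw [pow_sub₀ z hz hkn, inv_pow]
  ring

theorem sum_Icc_half_pow_le {n : ℕ} (hn : 2 ≤ n) :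
    ∑ k ∈ Finset.Icc 2 n, (1 / 2 : ℝ) ^ k ≤ 1 / 2 - (1 / 2) ^ n := by
  induction n, hn using Nat.le_induction with
  | base => norm_num
  | succ n hn ih =>
    rw [Finset.sum_Icc_succ_top (by omega)]
    have h : (1 / 2 : ℝ) ^ (n + 1) = (1 / 2) ^ n / 2 := by rw [pow_succ]; ring
    linarith

/-- The tail is dominated by a geometric sum from `k = 2`, which stays below `1 / 2`. Hence the
principal argument of `leadRatio` is continuous outside the disc of radius `2`. -/
theorem leadRatio_re_pos {n : ℕ} (hn : 2 ≤ n) {a : ℕ → ℂ} (ha : ∀ k ∈ Finset.Icc 2 n, ‖a k‖ ≤ 1)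
    {z : ℂ} (hz : 2 ≤ ‖z‖) : 0 < (leadRatio n a z).re := by
  have h1 : ‖∑ k ∈ Finset.Icc 2 n, a k * z⁻¹ ^ k‖ ≤ 1 / 2 := by
    refine (norm_sum_le _ _).trans ?_
    refine (Finset.sum_le_sum (g := fun k => (1 / 2 : ℝ) ^ k) fun k hk => ?_).trans
      ((sum_Icc_half_pow_le hn).trans (by linarith [pow_pos (show (0 : ℝ) < 1 / 2 by norm_num) n]))
    rw [norm_mul, norm_pow, norm_inv]
    have h2 : ‖z‖⁻¹ ≤ 1 / 2 := by
      rw [inv_eq_one_div]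
      exact one_div_le_one_div_of_le (by norm_num) hz
    have h3 := pow_le_pow_left₀ (by positivity) h2 k
    calc ‖a k‖ * ‖z‖⁻¹ ^ k ≤ 1 * ‖z‖⁻¹ ^ k := by gcongr; exact ha k hk
      _ ≤ _ := by rw [one_mul]; exact h3
  have h2 := Complex.abs_re_le_norm (∑ k ∈ Finset.Icc 2 n, a k * z⁻¹ ^ k)
  rw [leadRatio, Complex.add_re, Complex.one_re]
  linarith [neg_abs_le (∑ k ∈ Finset.Icc 2 n, a k * z⁻¹ ^ k).re]

theorem re_eval_centeredPoly_polar (n : ℕ) (a : ℕ → ℂ) {ρ : ℝ} (hρ : 0 < ρ) (ψ : ℝ) :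
    ((centeredPoly n a).eval (ρ * Complex.exp (ψ * Complex.I))).re =
      ρ ^ n * ‖leadRatio n a (ρ * Complex.exp (ψ * Complex.I))‖ *
        Real.cos (n * ψ + (leadRatio n a (ρ * Complex.exp (ψ * Complex.I))).arg) := by
  have hz : (ρ * Complex.exp (ψ * Complex.I) : ℂ) ≠ 0 :=
    mul_ne_zero (by exact_mod_cast hρ.ne') (Complex.exp_ne_zero _)
  rw [eval_centeredPoly_eq_mul_leadRatio n a hz]
  set q := leadRatio n a (ρ * Complex.exp (ψ * Complex.I))
  have h : (ρ * Complex.exp (ψ * Complex.I)) ^ n * q =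
      ((ρ ^ n * ‖q‖ : ℝ) : ℂ) * Complex.exp ((n * ψ + q.arg : ℝ) * Complex.I) := by
    conv_lhs => rw [← Complex.norm_mul_exp_arg_mul_I q]
    rw [mul_pow, ← Complex.exp_nat_mul]
    push_cast
    rw [add_mul, Complex.exp_add]
    ring_nf
  rw [h, Complex.re_ofReal_mul, Complex.exp_ofReal_mul_I_re]

/-- The sign `σ` selects the ray. As `t` grows the polar angle tends to `α + σ * (π / 2)`, which
fixes the phase at infinity. -/
theorem linePoint_polar (α d : ℝ) {t σ : ℝ} (ht : 0 < t) (hσ : σ = 1 ∨ σ = -1) :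
    linePoint α d (σ * t : ℝ) = (√(d ^ 2 + t ^ 2) : ℝ) *
      Complex.exp ((α + σ * Real.arccos (d / √(d ^ 2 + t ^ 2)) : ℝ) * Complex.I) := by
  set ρ := √(d ^ 2 + t ^ 2) with hρ
  have hρ2 : ρ ^ 2 = d ^ 2 + t ^ 2 := Real.sq_sqrt (by positivity)
  have hρ0 : 0 < ρ := Real.sqrt_pos.2 (by positivity)
  have hdρ : |d| ≤ ρ := Real.abs_le_sqrt (by nlinarith)
  have hc : ρ * Real.cos (Real.arccos (d / ρ)) = d := by
    rw [Real.cos_arccos]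
    · field_simp
    · rw [le_div_iff₀ hρ0]; linarith [neg_abs_le d]
    · rw [div_le_iff₀ hρ0]; linarith [le_abs_self d]
  have hs : ρ * Real.sin (Real.arccos (d / ρ)) = t := by
    have h : 1 - (d / ρ) ^ 2 = (t / ρ) ^ 2 := by
      field_simp
      linarith
    rw [Real.sin_arccos, h, Real.sqrt_sq (by positivity)]
    field_simp
  have hs' : ρ * Real.sin (σ * Real.arccos (d / ρ)) = σ * t := by
    rcases hσ with rfl | rfl
    · rw [one_mul, one_mul, hs]
    · rw [neg_one_mul, neg_one_mul, Real.sin_neg, mul_neg, hs]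
  have hc' : ρ * Real.cos (σ * Real.arccos (d / ρ)) = d := by
    rcases hσ with rfl | rfl
    · rw [one_mul, hc]
    · rw [neg_one_mul, Real.cos_neg, hc]
  have key : (d + Complex.I * (σ * t : ℝ) : ℂ) =
      ρ * Complex.exp ((σ * Real.arccos (d / ρ) : ℝ) * Complex.I) := by
    rw [Complex.exp_mul_I, ← Complex.ofReal_cos, ← Complex.ofReal_sin, mul_add, ← mul_assoc,
      ← Complex.ofReal_mul, ← Complex.ofReal_mul, hc', hs']
    ring
  rw [linePoint, key, Complex.ofReal_add, add_mul, Complex.exp_add]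
  ring

theorem continuous_linePoint (α d : ℝ) : Continuous (linePoint α d) := by
  unfold linePoint
  fun_prop

/-- The argument of a centered polynomial along the circle of radius `r`, relative to the
continuous branch of the argument of its leading term. -/
noncomputable def circlePhase (n : ℕ) (a : ℕ → ℂ) (r ω : ℝ) : ℝ :=
  n * ω + (leadRatio n a (r * Complex.exp (ω * Complex.I))).arg

theorem cos_mul_sub_half_pi_ne_zero {n : ℕ} {α σ : ℝ} (hσ : σ = 1 ∨ σ = -1)
    (hα : Real.cos (n * (α + Real.pi / 2)) ≠ 0) :
    Real.cos (n * (α + σ * (Real.pi / 2))) ≠ 0 := by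
  rcases hσ with rfl | rfl
  · rwa [one_mul]
  · have h : (n * (α + -1 * (Real.pi / 2)) : ℝ) = n * (α + Real.pi / 2) - n * Real.pi := by ring
    rw [h, Real.cos_sub_nat_mul_pi]
    exact mul_ne_zero (pow_ne_zero _ (by norm_num)) hα

/-- Lower bound for the number of zeros of `Re p` on one of the two rays that a disc cuts from a
line. -/
theorem exists_zeros_on_ray {n : ℕ} (hn : 2 ≤ n) {a : ℕ → ℂ}
    (ha : ∀ k ∈ Finset.Icc 2 n, ‖a k‖ ≤ 1) {α d r σ : ℝ} (hr : 2 ≤ r) (hd : |d| < r)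
    (hσ : σ = 1 ∨ σ = -1) (hα : Real.cos (n * (α + Real.pi / 2)) ≠ 0) :
    ∃ T : Finset ℝ, (∀ t ∈ T, √(r ^ 2 - d ^ 2) ≤ t ∧
        ((centeredPoly n a).eval (linePoint α d (σ * t : ℝ))).re = 0) ∧
      T.card = (crossIndex (n * (α + σ * (Real.pi / 2))) -
        crossIndex (circlePhase n a r (α + σ * Real.arccos (d / r)))).natAbs := by
  have hr0 : 0 < r := by linarith
  have hdr : 0 < r ^ 2 - d ^ 2 := by
    rw [← sq_abs d]
    nlinarith [abs_nonneg d]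
  -- Half the chord length: the parameter at which the line leaves the disc.
  set t₀ := √(r ^ 2 - d ^ 2) with ht₀
  have ht₀pos : 0 < t₀ := Real.sqrt_pos.2 hdr
  have hsq : t₀ ^ 2 = r ^ 2 - d ^ 2 := Real.sq_sqrt hdr.le
  set f : ℝ → ℝ := fun t => n * (α + σ * Real.arccos (d / √(d ^ 2 + t ^ 2))) +
    (leadRatio n a (linePoint α d (σ * t : ℝ))).arg with hf
  have hnorm : ∀ t, 0 < t → ‖linePoint α d (σ * t : ℝ)‖ = √(d ^ 2 + t ^ 2) := by
    intro t ht
    rw [linePoint_polar α d ht hσ, norm_mul, Complex.norm_exp_ofReal_mul_I, mul_one,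
      Complex.norm_real, Real.norm_of_nonneg (Real.sqrt_nonneg _)]
  have hge : ∀ t, t₀ ≤ t → 2 ≤ ‖linePoint α d (σ * t : ℝ)‖ := by
    intro t ht
    rw [hnorm t (ht₀pos.trans_le ht)]
    refine hr.trans (Real.le_sqrt_of_sq_le ?_)
    nlinarith
  have hcont : ContinuousOn f (Set.Ici t₀) := by
    refine ContinuousOn.add ?_ ?_
    · refine continuousOn_const.mul (continuousOn_const.add (continuousOn_const.mul
        (Real.continuous_arccos.comp_continuousOn
          (continuousOn_const.div (by fun_prop) fun t ht => ?_))))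
      have : 0 < t := ht₀pos.trans_le ht
      positivity
    · intro t ht
      have h2 := hge t ht
      have hne : linePoint α d (σ * t : ℝ) ≠ 0 := by
        intro h0
        rw [h0, norm_zero] at h2
        norm_num at h2
      have hlp : ContinuousAt (fun t : ℝ => linePoint α d (σ * t : ℝ)) t :=
        ((continuous_linePoint α d).comp (by fun_prop)).continuousAt
      have hlr : ContinuousAt (fun t : ℝ => leadRatio n a (linePoint α d (σ * t : ℝ))) t := by
        unfold leadRatio
        refine continuousAt_const.add (tendsto_finsetSum _ fun k _ => ?_)
        exact continuousAt_const.mul ((hlp.inv₀ hne).pow k)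
      exact (ContinuousAt.comp (f := fun t : ℝ => leadRatio n a (linePoint α d (σ * t : ℝ)))
        (Complex.continuousAt_arg (Or.inl (leadRatio_re_pos hn ha h2))) hlr).continuousWithinAt
  have hsqrt : Tendsto (fun t : ℝ => √(d ^ 2 + t ^ 2)) atTop atTop := by
    refine tendsto_atTop_mono (fun t => ?_) tendsto_id
    exact Real.le_sqrt_of_sq_le (by simp only [id]; nlinarith [sq_nonneg d])
  have hE : Tendsto f atTop (𝓝 (n * (α + σ * (Real.pi / 2)))) := by
    have h1 : Tendsto (fun t : ℝ => d / √(d ^ 2 + t ^ 2)) atTop (𝓝 0) := hsqrt.const_div_atTop d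
    have h2 : Tendsto (fun t : ℝ => Real.arccos (d / √(d ^ 2 + t ^ 2))) atTop
        (𝓝 (Real.pi / 2)) := by
      rw [← Real.arccos_zero]
      exact (Real.continuous_arccos.tendsto 0).comp h1
    have h3 : Tendsto (fun t : ℝ => (linePoint α d (σ * t : ℝ))⁻¹) atTop (𝓝 0) := by
      rw [tendsto_zero_iff_norm_tendsto_zero]
      refine (tendsto_inv_atTop_zero.comp hsqrt).congr' ?_
      filter_upwards [eventually_gt_atTop 0] with t ht
      rw [norm_inv, hnorm t ht, Function.comp]
    have h4 : Tendsto (fun t : ℝ => leadRatio n a (linePoint α d (σ * t : ℝ))) atTop (𝓝 1) := by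
      unfold leadRatio
      have : Tendsto (fun t : ℝ => 1 + ∑ k ∈ Finset.Icc 2 n,
          a k * (linePoint α d (σ * t : ℝ))⁻¹ ^ k) atTop
          (𝓝 (1 + ∑ k ∈ Finset.Icc 2 n, a k * 0 ^ k)) :=
        tendsto_const_nhds.add (tendsto_finsetSum _ fun k _ =>
          tendsto_const_nhds.mul (h3.pow k))
      rwa [Finset.sum_eq_zero, add_zero] at this
      intro k hk
      rw [zero_pow (by have := (Finset.mem_Icc.1 hk).1; omega), mul_zero]
    have h5 : Tendsto (fun t : ℝ => (leadRatio n a (linePoint α d (σ * t : ℝ))).arg) atTop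
        (𝓝 0) := by
      rw [← Complex.arg_one]
      exact (Complex.continuousAt_arg (by simp)).tendsto.comp h4
    have h6 := (tendsto_const_nhds (x := (n : ℝ))).mul ((tendsto_const_nhds (x := α)).add
      ((tendsto_const_nhds (x := σ)).mul h2))
    rw [← add_zero ((n : ℝ) * (α + σ * (Real.pi / 2)))]
    exact h6.add h5
  obtain ⟨T, hT, hcard⟩ := exists_finset_cos_eq_zero hcont hE (cos_mul_sub_half_pi_ne_zero hσ hα)
  refine ⟨T, fun t ht => ⟨(hT t ht).1, ?_⟩, ?_⟩
  · have htpos : 0 < t := ht₀pos.trans_le (hT t ht).1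
    have hcos := (hT t ht).2
    simp only [hf] at hcos
    rw [linePoint_polar α d htpos hσ] at hcos ⊢
    rw [re_eval_centeredPoly_polar n a (by positivity), hcos, mul_zero]
  · rw [hcard]
    have hρ : √(d ^ 2 + t₀ ^ 2) = r := by
      rw [hsq, add_sub_cancel, Real.sqrt_sq hr0.le]
    have : f t₀ = circlePhase n a r (α + σ * Real.arccos (d / r)) := by
      simp only [hf, circlePhase]
      rw [linePoint_polar α d ht₀pos hσ, hρ]
    rw [this]

/-- The signed distance from the origin of the line through `z` with normal `exp (α * I)`. -/
noncomputable def lineCoord (α : ℝ) (z : ℂ) : ℝ := z.re * Real.cos α + z.im * Real.sin α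

/-- The position of `z` along the line with normal `exp (α * I)` through it. -/
noncomputable def lineParam (α : ℝ) (z : ℂ) : ℝ := z.im * Real.cos α - z.re * Real.sin α

theorem linePoint_lineCoord_lineParam (α : ℝ) (z : ℂ) :
    linePoint α (lineCoord α z) (lineParam α z) = z := by
  have h := Real.sin_sq_add_cos_sq α
  rw [linePoint, Complex.exp_mul_I, ← Complex.ofReal_cos, ← Complex.ofReal_sin]
  apply Complex.ext
  · simp [lineCoord, lineParam, -Complex.ofReal_cos, -Complex.ofReal_sin]
    linear_combination z.re * h
  · simp [lineCoord, lineParam, -Complex.ofReal_cos, -Complex.ofReal_sin]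
    linear_combination z.im * h

theorem lineCoord_sq_add_lineParam_sq (α : ℝ) (z : ℂ) :
    lineCoord α z ^ 2 + lineParam α z ^ 2 = ‖z‖ ^ 2 := by
  have h := Real.sin_sq_add_cos_sq α
  rw [Complex.sq_norm, Complex.normSq_apply, lineCoord, lineParam]
  linear_combination (z.re ^ 2 + z.im ^ 2) * h

/-- The number of sign changes of `Re p` forced outside the disc of radius `r` on a line. -/
noncomputable def outerCount (n : ℕ) (a : ℕ → ℂ) (r α d : ℝ) : ℕ :=
  (crossIndex (n * (α + Real.pi / 2)) -
    crossIndex (circlePhase n a r (α + Real.arccos (d / r)))).natAbs +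
  (crossIndex (n * (α - Real.pi / 2)) -
    crossIndex (circlePhase n a r (α - Real.arccos (d / r)))).natAbs

open Classical in
-- The chord and the two outer rays occupy disjoint parameter ranges, so their zeros add up within
-- the bound for the whole line.
theorem card_add_outerCount_le {n : ℕ} (hn : 2 ≤ n) {a : ℕ → ℂ}
    (ha : ∀ k ∈ Finset.Icc 2 n, ‖a k‖ ≤ 1) {α d r : ℝ} (hr : 2 ≤ r) (hd : |d| < r)
    (hα : Real.cos (n * (α + Real.pi / 2)) ≠ 0) (Z : Finset ℂ)
    (hZ : ∀ z ∈ Z, z ∈ reZeroSet (centeredPoly n a) ∩ Metric.ball 0 r ∧ lineCoord α z = d) :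
    Z.card + outerCount n a r α d + (if lineDefective n a α d then 1 else 0) ≤ n := by
  obtain ⟨T₁, hT₁, hc₁⟩ := exists_zeros_on_ray hn ha hr hd (Or.inl rfl) hα
  obtain ⟨T₂, hT₂, hc₂⟩ := exists_zeros_on_ray hn ha hr hd (Or.inr rfl) hα
  have hdr : 0 < r ^ 2 - d ^ 2 := by
    rw [← sq_abs d]
    nlinarith [abs_nonneg d]
  have ht₀pos : 0 < √(r ^ 2 - d ^ 2) := Real.sqrt_pos.2 hdr
  set T₀ := Z.image (lineParam α) with hT₀
  have hin : ∀ t ∈ T₀, |t| < √(r ^ 2 - d ^ 2) := by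
    intro t ht
    obtain ⟨z, hz, rfl⟩ := Finset.mem_image.1 ht
    obtain ⟨⟨_, hzr⟩, hzd⟩ := hZ z hz
    have hzr' : ‖z‖ < r := by simpa using hzr
    have h := lineCoord_sq_add_lineParam_sq α z
    rw [hzd] at h
    apply Real.lt_sqrt_of_sq_lt
    rw [sq_abs]
    nlinarith [norm_nonneg z]
  have hc₀ : T₀.card = Z.card := by
    apply Finset.card_image_of_injOn
    intro z hz w hw hzw
    rw [← linePoint_lineCoord_lineParam α z, ← linePoint_lineCoord_lineParam α w,
      (hZ z hz).2, (hZ w hw).2]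
    exact congrArg (fun t : ℝ => linePoint α d t) hzw
  -- The second ray was parametrised by positive `t`; reflection puts its zeros at their true
  -- parameters.
  set T₃ := T₂.image (fun t => -t) with hT₃
  have hc₃ : T₃.card = T₂.card := Finset.card_image_of_injective _ neg_injective
  have hd01 : Disjoint T₀ T₁ := by
    rw [Finset.disjoint_left]
    intro t h0 h1
    linarith [hin t h0, (hT₁ t h1).1, le_abs_self t]
  have hd2 : Disjoint (T₀ ∪ T₁) T₃ := by
    rw [Finset.disjoint_left]
    intro t h0 h1
    obtain ⟨s, hs, rfl⟩ := Finset.mem_image.1 h1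
    have hs' := (hT₂ s hs).1
    rcases Finset.mem_union.1 h0 with h | h
    · have := hin _ h
      rw [abs_neg] at this
      linarith [le_abs_self s]
    · linarith [(hT₁ _ h).1]
  have key := card_le_of_line_zeros hn a d hα ((T₀ ∪ T₁) ∪ T₃) (by
    intro t ht
    rcases Finset.mem_union.1 ht with h | h
    · rcases Finset.mem_union.1 h with h | h
      · obtain ⟨z, hz, rfl⟩ := Finset.mem_image.1 h
        obtain ⟨⟨hz0, _⟩, hzd⟩ := hZ z hz
        rw [← hzd, linePoint_lineCoord_lineParam]
        exact hz0
      · simpa using (hT₁ t h).2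
    · obtain ⟨s, hs, rfl⟩ := Finset.mem_image.1 h
      simpa using (hT₂ s hs).2)
  rw [Finset.card_union_of_disjoint hd2, Finset.card_union_of_disjoint hd01, hc₀, hc₃, hc₁,
    hc₂] at key
  rw [outerCount]
  simp only [one_mul, neg_one_mul, ← sub_eq_add_neg] at key
  omega

/-! ### An integral-geometric upper bound for length -/

theorem continuous_lineCoord (α : ℝ) : Continuous (lineCoord α) := by
  unfold lineCoord
  fun_prop

theorem lineCoord_sub (α : ℝ) (z w : ℂ) :
    lineCoord α (z - w) = lineCoord α z - lineCoord α w := by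
  simp only [lineCoord, Complex.sub_re, Complex.sub_im]
  ring

theorem lineCoord_eq_rotate (α τ : ℝ) (z : ℂ) :
    lineCoord α z = (Complex.exp (τ * Complex.I) * z).re * Real.cos (α + τ) +
      (Complex.exp (τ * Complex.I) * z).im * Real.sin (α + τ) := by
  have h := Real.sin_sq_add_cos_sq τ
  rw [Complex.mul_re, Complex.mul_im, Complex.exp_ofReal_mul_I_re, Complex.exp_ofReal_mul_I_im,
    Real.cos_add, Real.sin_add, lineCoord]
  linear_combination (-(z.re * Real.cos α) - z.im * Real.sin α) * h

/-- If the chords of `E` are almost parallel to a fixed direction, then the projection of `E`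
along a transversal direction does not shrink distances much. -/
theorem le_abs_lineCoord_sub {ε τ : ℝ} {z w : ℂ}
    (h : |(Complex.exp (τ * Complex.I) * (z - w)).re| ≤ ε * ‖z - w‖) (α : ℝ) :
    (|Real.sin (α + τ)| - 2 * ε) * ‖z - w‖ ≤ |lineCoord α z - lineCoord α w| := by
  rw [← lineCoord_sub, lineCoord_eq_rotate α τ]
  set ξ := Complex.exp (τ * Complex.I) * (z - w) with hξ
  have hn : ‖ξ‖ = ‖z - w‖ := by rw [hξ, norm_mul, Complex.norm_exp_ofReal_mul_I, one_mul]
  rw [← hn] at h ⊢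
  have h1 : ‖ξ‖ ≤ |ξ.re| + |ξ.im| := Complex.norm_le_abs_re_add_abs_im ξ
  have h2 : |ξ.im * Real.sin (α + τ)| - |ξ.re * Real.cos (α + τ)| ≤
      |ξ.re * Real.cos (α + τ) + ξ.im * Real.sin (α + τ)| := by
    have := abs_sub_abs_le_abs_sub (ξ.im * Real.sin (α + τ)) (-(ξ.re * Real.cos (α + τ)))
    rwa [abs_neg, sub_neg_eq_add, add_comm (ξ.im * _)] at this
  rw [abs_mul, abs_mul] at h2
  have h3 : |ξ.re| * |Real.cos (α + τ)| ≤ |ξ.re| :=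
    mul_le_of_le_one_right (abs_nonneg _) (Real.abs_cos_le_one _)
  have h4 : (‖ξ‖ - |ξ.re|) * |Real.sin (α + τ)| ≤ |ξ.im| * |Real.sin (α + τ)| := by
    gcongr
    linarith
  have h5 : |ξ.re| * |Real.sin (α + τ)| ≤ |ξ.re| :=
    mul_le_of_le_one_right (abs_nonneg _) (Real.abs_sin_le_one _)
  nlinarith

theorem injOn_lineCoord {κ α : ℝ} (hκ : 0 < κ) {E : Set ℂ}
    (h : ∀ z ∈ E, ∀ w ∈ E, κ * ‖z - w‖ ≤ |lineCoord α z - lineCoord α w|) :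
    Set.InjOn (lineCoord α) E := by
  intro z hz w hw hzw
  have h1 := h z hz w hw
  rw [hzw, sub_self, abs_zero] at h1
  have h2 : ‖z - w‖ = 0 := le_antisymm (by nlinarith [norm_nonneg (z - w)]) (norm_nonneg _)
  exact sub_eq_zero.1 (norm_eq_zero.1 h2)

/-- The projection has an inverse on its image that is Lipschitz with constant `κ⁻¹`, and on the
real line Hausdorff measure is Lebesgue measure. -/
theorem ofReal_mul_hausdorffMeasure_le {κ α : ℝ} (hκ : 0 < κ) {E : Set ℂ}
    (h : ∀ z ∈ E, ∀ w ∈ E, κ * ‖z - w‖ ≤ |lineCoord α z - lineCoord α w|) :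
    ENNReal.ofReal κ * Measure.hausdorffMeasure 1 E ≤ volume (lineCoord α '' E) := by
  have hinj := injOn_lineCoord hκ h
  set g := Function.invFunOn (lineCoord α) E with hg
  have hgE : ∀ z ∈ E, g (lineCoord α z) = z := fun z hz => hinj.leftInvOn_invFunOn hz
  have hlip : LipschitzOnWith (Real.toNNReal κ⁻¹) g (lineCoord α '' E) := by
    apply LipschitzOnWith.of_dist_le_mul
    rintro _ ⟨z, hz, rfl⟩ _ ⟨w, hw, rfl⟩
    rw [hgE z hz, hgE w hw, dist_eq_norm, Real.dist_eq, Real.coe_toNNReal _ (by positivity)]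
    have := h z hz w hw
    rw [inv_mul_eq_div, le_div_iff₀ hκ]
    linarith
  have himg : g '' (lineCoord α '' E) = E := by
    rw [Set.image_image]
    exact (Set.image_congr hgE).trans (Set.image_id' E)
  have h1 := hlip.hausdorffMeasure_image_le (d := 1) zero_le_one
  rw [himg, hausdorffMeasure_real, ENNReal.rpow_one] at h1
  calc ENNReal.ofReal κ * Measure.hausdorffMeasure 1 E
      ≤ ENNReal.ofReal κ * (ENNReal.ofReal κ⁻¹ * volume (lineCoord α '' E)) := by
        gcongr
        exact h1
    _ = volume (lineCoord α '' E) := by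
        rw [← mul_assoc, ← ENNReal.ofReal_mul hκ.le, mul_inv_cancel₀ hκ.ne', ENNReal.ofReal_one,
          one_mul]

/-- By strict differentiability `p z - p w` is close to `b * (z - w)`, and its real part vanishes on
the zero set. Rotating by `arg b` therefore makes every short chord almost imaginary. -/
theorem exists_nhds_chords {p : ℂ[X]} {z₀ : ℂ} (h0 : p.derivative.eval z₀ ≠ 0) {ε : ℝ}
    (hε : 0 < ε) : ∃ (U : Set ℂ) (τ : ℝ), IsOpen U ∧ z₀ ∈ U ∧
      ∀ z ∈ U ∩ reZeroSet p, ∀ w ∈ U ∩ reZeroSet p,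
        |(Complex.exp (τ * Complex.I) * (z - w)).re| ≤ ε * ‖z - w‖ := by
  set b := p.derivative.eval z₀ with hb
  have hbpos : 0 < ‖b‖ := norm_pos_iff.2 h0
  have hs : HasStrictDerivAt (fun z => p.eval z) b z₀ := p.hasStrictDerivAt z₀
  have hev := hs.isLittleO.def (mul_pos hε hbpos)
  rw [nhds_prod_eq] at hev
  obtain ⟨V, hV, hV'⟩ := eventually_prod_self_iff'.1 hev
  obtain ⟨U, hUV, hUo, hzU⟩ := mem_nhds_iff.1 hV
  refine ⟨U, b.arg, hUo, hzU, ?_⟩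
  rintro z ⟨hzU, hz⟩ w ⟨hwU, hw⟩
  have h1 := hV' z (hUV hzU) w (hUV hwU)
  simp only [ContinuousLinearMap.toSpanSingleton_apply, smul_eq_mul] at h1
  have h2 := (Complex.abs_re_le_norm _).trans h1
  rw [reZeroSet, Set.mem_ofPred_eq] at hz hw
  rw [Complex.sub_re, Complex.sub_re, hz, hw, sub_zero, zero_sub, abs_neg] at h2
  have h3 : (z - w) * b = (‖b‖ : ℂ) * (Complex.exp (b.arg * Complex.I) * (z - w)) := by
    conv_lhs => rw [← Complex.norm_mul_exp_arg_mul_I b]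
    ring
  rw [h3, Complex.re_ofReal_mul, abs_mul, abs_of_pos hbpos] at h2
  refine le_of_mul_le_mul_left ?_ hbpos
  linarith

/-- Off the finitely many critical points, a Lindelöf subcover by chord neighbourhoods is made
disjoint; only critical points can be left over. -/
theorem exists_countable_pieces {p : ℂ[X]} (hp : p.derivative ≠ 0) {S : Set ℂ}
    (hS : MeasurableSet S) (hSp : S ⊆ reZeroSet p) {ε : ℝ} (hε : 0 < ε) :
    ∃ (E : ℕ → Set ℂ) (τ : ℕ → ℝ), (∀ i, MeasurableSet (E i)) ∧
      Pairwise (Function.onFun Disjoint E) ∧ (∀ i, E i ⊆ S) ∧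
      (S \ ⋃ i, E i).Countable ∧
      ∀ i, ∀ z ∈ E i, ∀ w ∈ E i,
        |(Complex.exp (τ i * Complex.I) * (z - w)).re| ≤ ε * ‖z - w‖ := by
  set N : Set ℂ := {z | p.derivative.eval z = 0} with hN
  have hNfin : N.Finite := by
    refine (p.derivative.roots.toFinset.finite_toSet).subset fun z hz => ?_
    rw [Finset.mem_coe, Multiset.mem_toFinset, mem_roots hp]
    exact hz
  have hex : ∀ z ∈ Nᶜ, ∃ (U : Set ℂ) (τ : ℝ), IsOpen U ∧ z ∈ U ∧
      ∀ z ∈ U ∩ reZeroSet p, ∀ w ∈ U ∩ reZeroSet p,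
        |(Complex.exp (τ * Complex.I) * (z - w)).re| ≤ ε * ‖z - w‖ :=
    fun z hz => exists_nhds_chords hz hε
  choose! U τ hUo hzU hU using hex
  obtain ⟨t, htN, htc, hcov⟩ := TopologicalSpace.countable_cover_nhdsWithin (s := Nᶜ) (f := U)
    fun z hz => mem_nhdsWithin_of_mem_nhds ((hUo z hz).mem_nhds (hzU z hz))
  have hne : t.Nonempty := by
    by_contra hne
    rw [Set.not_nonempty_iff_eq_empty.1 hne] at hcov
    obtain ⟨z, hz⟩ := hNfin.infinite_compl.nonempty
    simpa using hcov hz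
  obtain ⟨f, rfl⟩ := htc.exists_eq_range hne
  have hfN : ∀ i, f i ∈ Nᶜ := fun i => htN ⟨i, rfl⟩
  have hdis := disjoint_disjointed (fun i => U (f i))
  refine ⟨fun i => S ∩ disjointed (fun i => U (f i)) i, fun i => τ (f i), ?_, ?_, ?_, ?_, ?_⟩
  · intro i
    exact hS.inter (MeasurableSet.disjointed (fun i => (hUo _ (hfN i)).measurableSet) i)
  · intro i j hij
    exact (hdis hij).mono Set.inter_subset_right Set.inter_subset_right
  · exact fun i => Set.inter_subset_left
  · refine hNfin.countable.mono ?_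
    rintro z ⟨hzS, hz⟩
    by_contra hzN
    apply hz
    rw [← Set.inter_iUnion, iUnion_disjointed]
    refine ⟨hzS, ?_⟩
    simpa using hcov hzN
  · intro i z hz w hw
    exact hU (f i) (hfN i) z ⟨disjointed_subset (fun i => U (f i)) i hz.2, hSp hz.1⟩ w
      ⟨disjointed_subset (fun i => U (f i)) i hw.2, hSp hw.1⟩

theorem integral_abs_sin_add (τ : ℝ) :
    ∫ α in (0 : ℝ)..2 * Real.pi, |Real.sin (α + τ)| = 4 := by
  have hper : Function.Periodic (fun x => |Real.sin x|) Real.pi := by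
    intro x
    simp [Real.sin_add_pi]
  have hint : ∀ a b : ℝ, IntervalIntegrable (fun x => |Real.sin x|) volume a b :=
    fun a b => (Real.continuous_sin.abs).intervalIntegrable a b
  have h0 : ∫ x in (0 : ℝ)..Real.pi, |Real.sin x| = 2 := by
    have h : ∫ x in (0 : ℝ)..Real.pi, |Real.sin x| = ∫ x in (0 : ℝ)..Real.pi, Real.sin x := by
      refine intervalIntegral.integral_congr fun x hx => ?_
      rw [Set.uIcc_of_le Real.pi_pos.le] at hx
      exact abs_of_nonneg (Real.sin_nonneg_of_nonneg_of_le_pi hx.1 hx.2)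
    rw [h, integral_sin]
    norm_num
  rw [intervalIntegral.integral_comp_add_right (fun x => |Real.sin x|)]
  have h1 := hper.intervalIntegral_add_eq τ 0
  have h2 := hper.intervalIntegral_add_eq (τ + Real.pi) 0
  rw [zero_add, h0] at h1 h2
  rw [zero_add, show 2 * Real.pi + τ = τ + Real.pi + Real.pi by ring,
    ← intervalIntegral.integral_add_adjacent_intervals (hint τ (τ + Real.pi)) (hint _ _), h1, h2]
  norm_num

/-- The loss `2 * ε` over an interval of length `2π` costs `4πε`; truncation at zero only increases
the integral. -/
theorem ofReal_le_lintegral_abs_sin (ε τ : ℝ) :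
    ENNReal.ofReal (4 - 4 * Real.pi * ε) ≤
      ∫⁻ α in Set.Ioc 0 (2 * Real.pi), ENNReal.ofReal (|Real.sin (α + τ)| - 2 * ε) := by
  have h2π : (0 : ℝ) ≤ 2 * Real.pi := by positivity
  have hc : Continuous (fun α : ℝ => |Real.sin (α + τ)| - 2 * ε) := by fun_prop
  have hc' : Continuous (fun α : ℝ => max (|Real.sin (α + τ)| - 2 * ε) 0) := by fun_prop
  have hi : ∫ α in (0 : ℝ)..2 * Real.pi, (|Real.sin (α + τ)| - 2 * ε) = 4 - 4 * Real.pi * ε := by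
    rw [intervalIntegral.integral_sub
      ((by fun_prop : Continuous fun α : ℝ => |Real.sin (α + τ)|).intervalIntegrable _ _)
      (by simp), integral_abs_sin_add, intervalIntegral.integral_const]
    simp only [smul_eq_mul]
    ring
  rw [← hi]
  calc ENNReal.ofReal (∫ α in (0 : ℝ)..2 * Real.pi, (|Real.sin (α + τ)| - 2 * ε))
      ≤ ENNReal.ofReal (∫ α in (0 : ℝ)..2 * Real.pi, max (|Real.sin (α + τ)| - 2 * ε) 0) := by
        apply ENNReal.ofReal_le_ofReal
        exact intervalIntegral.integral_mono_on h2π (hc.intervalIntegrable _ _)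
          (hc'.intervalIntegrable _ _) fun α _ => le_max_left _ _
    _ = ∫⁻ α in Set.Ioc 0 (2 * Real.pi), ENNReal.ofReal (max (|Real.sin (α + τ)| - 2 * ε) 0) := by
        rw [intervalIntegral.integral_of_le h2π, ofReal_integral_eq_lintegral_ofReal]
        · exact (hc'.integrableOn_Icc).mono_set Set.Ioc_subset_Icc_self
        · exact ae_of_all _ fun α => le_max_right _ _
    _ = _ := by
        congr 1
        ext α
        rw [ENNReal.ofReal_max, ENNReal.ofReal_zero, max_eq_left (zero_le)]

/-- One point chosen on the line in each piece that it meets gives distinct points of `S`, the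
pieces being disjoint. -/
theorem tsum_indicator_image_le {E : ℕ → Set ℂ} {S : Set ℂ}
    (hdis : Pairwise (Function.onFun Disjoint E)) (hES : ∀ i, E i ⊆ S) {α d : ℝ} {b : ℝ≥0∞}
    (hb : ∀ Z : Finset ℂ, (∀ z ∈ Z, z ∈ S ∧ lineCoord α z = d) → (Z.card : ℝ≥0∞) ≤ b) :
    ∑' i, (lineCoord α '' E i).indicator (fun _ => (1 : ℝ≥0∞)) d ≤ b := by
  classical
  rw [ENNReal.tsum_eq_iSup_sum]
  refine iSup_le fun s => ?_
  set s' := s.filter (fun i => d ∈ lineCoord α '' E i) with hs'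
  have hch : ∀ i ∈ s', ∃ z ∈ E i, lineCoord α z = d := fun i hi => (Finset.mem_filter.1 hi).2
  choose! ζ hζE hζd using hch
  have hcard : (s'.image ζ).card = s'.card := by
    apply Finset.card_image_of_injOn
    intro i hi j hj hij
    by_contra hne
    have h2 := hζE j hj
    rw [← hij] at h2
    exact Set.disjoint_left.1 (hdis hne) (hζE i hi) h2
  have hsum : ∑ i ∈ s, (lineCoord α '' E i).indicator (fun _ => (1 : ℝ≥0∞)) d = (s'.card : ℝ≥0∞) := by
    simp only [Set.indicator_apply]
    rw [Finset.sum_ite, Finset.sum_const_zero, add_zero, Finset.sum_const, nsmul_one]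
  rw [hsum, ← hcard]
  apply hb
  intro z hz
  obtain ⟨i, hi, rfl⟩ := Finset.mem_image.1 hz
  exact ⟨hES i (hζE i hi), hζd i hi⟩

/-- The upper half of the Cauchy–Crofton formula for subsets of the zero set of `Re p`. -/
theorem four_mul_hausdorffMeasure_le {p : ℂ[X]} (hp : p.derivative ≠ 0) {S : Set ℂ}
    (hS : MeasurableSet S) (hSp : S ⊆ reZeroSet p) {g : ℝ → ℝ → ℝ≥0∞}
    (hg : ∀ᵐ α ∂volume.restrict (Set.Ioc 0 (2 * Real.pi)), ∀ d, ∀ Z : Finset ℂ,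
      (∀ z ∈ Z, z ∈ S ∧ lineCoord α z = d) → (Z.card : ℝ≥0∞) ≤ g α d) :
    4 * Measure.hausdorffMeasure 1 S ≤ ∫⁻ α in Set.Ioc 0 (2 * Real.pi), ∫⁻ d, g α d := by
  have key : ∀ ε : ℝ, 0 < ε → ENNReal.ofReal (4 - 4 * Real.pi * ε) *
      Measure.hausdorffMeasure 1 S ≤ ∫⁻ α in Set.Ioc 0 (2 * Real.pi), ∫⁻ d, g α d := by
    intro ε hε
    obtain ⟨E, τ, hEm, hdis, hES, hrest, hchord⟩ := exists_countable_pieces hp hS hSp hε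
    have h1 : Measure.hausdorffMeasure 1 S ≤ ∑' i, Measure.hausdorffMeasure 1 (E i) := by
      have hsub : S ⊆ (S \ ⋃ i, E i) ∪ ⋃ i, E i := by
        intro z hz
        by_cases h : z ∈ ⋃ i, E i
        · exact Or.inr h
        · exact Or.inl ⟨hz, h⟩
      have : NullSingletonClass (Measure.hausdorffMeasure 1 : Measure ℂ) :=
        Measure.nullSingletonClass_hausdorff ℂ one_pos
      refine (measure_mono hsub).trans ((measure_union_le _ _).trans ?_)
      rw [hrest.measure_zero, zero_add]
      exact measure_iUnion_le _
    calc ENNReal.ofReal (4 - 4 * Real.pi * ε) * Measure.hausdorffMeasure 1 S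
        ≤ ENNReal.ofReal (4 - 4 * Real.pi * ε) * ∑' i, Measure.hausdorffMeasure 1 (E i) := by
          gcongr
      _ = ∑' i, ENNReal.ofReal (4 - 4 * Real.pi * ε) * Measure.hausdorffMeasure 1 (E i) :=
          ENNReal.tsum_mul_left.symm
      _ ≤ ∑' i, ∫⁻ α in Set.Ioc 0 (2 * Real.pi),
            ENNReal.ofReal (|Real.sin (α + τ i)| - 2 * ε) * Measure.hausdorffMeasure 1 (E i) := by
          refine ENNReal.tsum_le_tsum fun i => ?_
          rw [lintegral_mul_const _ (by fun_prop)]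
          gcongr
          exact ofReal_le_lintegral_abs_sin ε (τ i)
      _ = ∫⁻ α in Set.Ioc 0 (2 * Real.pi), ∑' i,
            ENNReal.ofReal (|Real.sin (α + τ i)| - 2 * ε) * Measure.hausdorffMeasure 1 (E i) :=
          (lintegral_tsum fun i => by fun_prop).symm
      _ ≤ ∫⁻ α in Set.Ioc 0 (2 * Real.pi), ∫⁻ d, g α d := by
          refine lintegral_mono_ae ?_
          filter_upwards [hg] with α hα
          -- In directions nearly degenerate for the piece, the truncated factor is zero and nothing
          -- has to be proved.
          have hpiece : ∀ i, ENNReal.ofReal (|Real.sin (α + τ i)| - 2 * ε) *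
              Measure.hausdorffMeasure 1 (E i) ≤ ∫⁻ d, if 0 < |Real.sin (α + τ i)| - 2 * ε then
                (lineCoord α '' E i).indicator (fun _ => (1 : ℝ≥0∞)) d else 0 := by
            intro i
            by_cases hκ : 0 < |Real.sin (α + τ i)| - 2 * ε
            · simp only [hκ, if_true]
              have hE : ∀ z ∈ E i, ∀ w ∈ E i, (|Real.sin (α + τ i)| - 2 * ε) * ‖z - w‖ ≤
                  |lineCoord α z - lineCoord α w| :=
                fun z hz w hw => le_abs_lineCoord_sub (hchord i z hz w hw) α
              -- The image is Borel because the projection is continuous and injective on a Borel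
              -- piece.
              rw [lintegral_indicator_const ((hEm i).image_of_continuousOn_injOn
                (continuous_lineCoord α).continuousOn (injOn_lineCoord hκ hE)), one_mul]
              exact ofReal_mul_hausdorffMeasure_le hκ hE
            · rw [ENNReal.ofReal_of_nonpos (not_lt.1 hκ), zero_mul]
              exact zero_le
          refine (ENNReal.tsum_le_tsum hpiece).trans ?_
          rw [← lintegral_tsum]
          · refine lintegral_mono fun d => ?_
            refine le_trans (ENNReal.tsum_le_tsum fun i => ?_)
              (tsum_indicator_image_le hdis hES (hα d))
            split_ifs
            · exact le_rfl
            · exact zero_le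
          · intro i
            by_cases hκ : 0 < |Real.sin (α + τ i)| - 2 * ε
            · simp only [hκ, if_true]
              have hE : ∀ z ∈ E i, ∀ w ∈ E i, (|Real.sin (α + τ i)| - 2 * ε) * ‖z - w‖ ≤
                  |lineCoord α z - lineCoord α w| :=
                fun z hz w hw => le_abs_lineCoord_sub (hchord i z hz w hw) α
              exact (measurable_const.indicator ((hEm i).image_of_continuousOn_injOn
                (continuous_lineCoord α).continuousOn (injOn_lineCoord hκ hE))).aemeasurable
            · simp only [hκ, if_false]
              exact aemeasurable_const
  have hlim : Tendsto (fun ε : ℝ => ENNReal.ofReal (4 - 4 * Real.pi * ε) *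
      Measure.hausdorffMeasure 1 S) (𝓝[>] 0) (𝓝 (4 * Measure.hausdorffMeasure 1 S)) := by
    refine ENNReal.Tendsto.mul_const ?_ (Or.inl (by norm_num))
    have h : Tendsto (fun ε : ℝ => ENNReal.ofReal (4 - 4 * Real.pi * ε)) (𝓝 0)
        (𝓝 (ENNReal.ofReal (4 - 4 * Real.pi * 0))) :=
      (ENNReal.continuous_ofReal.comp (by fun_prop)).tendsto 0
    simp only [mul_zero, sub_zero] at h
    rw [show ENNReal.ofReal 4 = 4 by norm_num] at h
    exact h.mono_left nhdsWithin_le_nhds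
  refine le_of_tendsto hlim ?_
  filter_upwards [self_mem_nhdsWithin] with ε hε
  exact key ε hε

/-! ### The mean number of zeros outside a disc -/

theorem measurable_crossIndex : Measurable crossIndex := by
  unfold crossIndex
  exact Int.measurable_floor.comp (by fun_prop)

theorem abs_crossIndex_le (x : ℝ) : |(crossIndex x : ℝ)| ≤ |x| / Real.pi + 1 := by
  have h1 := Int.floor_le (x / Real.pi + 1 / 2)
  have h2 := Int.lt_floor_add_one (x / Real.pi + 1 / 2)
  have h3 : |x / Real.pi| = |x| / Real.pi := by rw [abs_div, abs_of_pos Real.pi_pos]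
  have h4 := abs_le.1 h3.le
  rw [crossIndex, abs_le]
  constructor <;> linarith [h4.1, h4.2]

theorem intervalIntegrable_crossIndex {f : ℝ → ℝ} (hf : Measurable f) {B D : ℝ}
    (hb : ∀ x, |f x| ≤ B + D * |x|) (s t : ℝ) :
    IntervalIntegrable (fun x => (crossIndex (f x) : ℝ)) volume s t := by
  have hg : Continuous fun x : ℝ => (B + D * |x|) / Real.pi + 1 := by fun_prop
  refine (hg.intervalIntegrable s t).mono_fun ?_ (ae_of_all _ fun x => ?_)
  · exact ((measurable_from_top (f := fun m : ℤ => (m : ℝ))).comp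
      (measurable_crossIndex.comp hf)).aestronglyMeasurable
  · simp only [Real.norm_eq_abs]
    refine (abs_crossIndex_le (f x)).trans (le_trans ?_ (le_abs_self _))
    gcongr
    exact hb x

theorem intervalIntegrable_fract_comp {f : ℝ → ℝ} (hf : Measurable f) (s t : ℝ) :
    IntervalIntegrable (fun x : ℝ => Int.fract (f x)) volume s t := by
  refine (continuous_const (y := (1 : ℝ)).intervalIntegrable s t).mono_fun
    (measurable_fract.comp hf).aestronglyMeasurable (ae_of_all _ fun x => ?_)
  simp only [Real.norm_of_nonneg (Int.fract_nonneg (f x)), norm_one]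
  exact (Int.fract_lt_one _).le

theorem integral_fract_unit : ∫ x in (0 : ℝ)..1, Int.fract x = 1 / 2 := by
  have h : ∫ x in (0 : ℝ)..1, Int.fract x = ∫ x in (0 : ℝ)..1, x := by
    rw [intervalIntegral.integral_of_le zero_le_one, intervalIntegral.integral_of_le zero_le_one,
      integral_Ioc_eq_integral_Ioo, integral_Ioc_eq_integral_Ioo]
    refine setIntegral_congr_fun measurableSet_Ioo fun x hx => ?_
    exact Int.fract_eq_self.2 ⟨hx.1.le, hx.2⟩
  rw [h, integral_id]
  norm_num

theorem integral_fract_period (b : ℝ) (m : ℕ) : ∫ x in b..b + m, Int.fract x = (m : ℝ) / 2 := by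
  have hper : Function.Periodic (fun x : ℝ => Int.fract x) 1 := fun x => Int.fract_add_one x
  have h := hper.intervalIntegral_add_zsmul_eq m b
    (intervalIntegrable_fract_comp measurable_id)
  have h1 := hper.intervalIntegral_add_eq b 0
  rw [zero_add, integral_fract_unit] at h1
  rw [h1] at h
  simpa [div_eq_mul_inv] using h

/-- The floor is a linear function minus a fractional part. The latter runs through exactly `2 * n`
periods with mean `1 / 2`, cancelling the shift by one half. -/
theorem integral_crossIndex {n : ℕ} (hn : n ≠ 0) (c : ℝ) :
    ∫ α in (0 : ℝ)..2 * Real.pi, (crossIndex (n * α + c) : ℝ) = 2 * Real.pi * n + 2 * c := by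
  have hπ := Real.pi_ne_zero
  have hn' : (n : ℝ) ≠ 0 := by exact_mod_cast hn
  have h1 : ∀ α : ℝ, (crossIndex (n * α + c) : ℝ) =
      ((n / Real.pi) * α + (c / Real.pi + 1 / 2)) -
        Int.fract ((n / Real.pi) * α + (c / Real.pi + 1 / 2)) := by
    intro α
    rw [crossIndex, Int.self_sub_fract]
    congr 2
    ring
  simp only [h1]
  rw [intervalIntegral.integral_sub]
  · rw [intervalIntegral.integral_comp_mul_add (fun x => Int.fract x) (by positivity)]
    have h2 : n / Real.pi * (2 * Real.pi) + (c / Real.pi + 1 / 2) =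
        n / Real.pi * 0 + (c / Real.pi + 1 / 2) + ((2 * n : ℕ) : ℝ) := by
      push_cast
      field_simp
      ring
    rw [h2, integral_fract_period, intervalIntegral.integral_add, intervalIntegral.integral_const_mul,
      integral_id, intervalIntegral.integral_const]
    · simp only [smul_eq_mul]
      push_cast
      field_simp
      ring
    · exact (by fun_prop : Continuous fun x : ℝ => n / Real.pi * x).intervalIntegrable _ _
    · exact continuous_const.intervalIntegrable _ _
  · exact (by fun_prop : Continuous fun x : ℝ => n / Real.pi * x +
      (c / Real.pi + 1 / 2)).intervalIntegrable _ _
  · exact intervalIntegrable_fract_comp (by fun_prop) _ _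

theorem crossIndex_add_nat_mul_pi (x : ℝ) (m : ℕ) :
    crossIndex (x + m * Real.pi) = crossIndex x + m := by
  rw [crossIndex, crossIndex, ← Int.floor_add_natCast]
  congr 1
  field_simp
  ring

theorem measurable_leadRatio (n : ℕ) (a : ℕ → ℂ) : Measurable (leadRatio n a) := by
  unfold leadRatio
  fun_prop

theorem measurable_circlePhase (n : ℕ) (a : ℕ → ℂ) (r : ℝ) : Measurable (circlePhase n a r) := by
  unfold circlePhase
  have h : Measurable fun ω : ℝ => (r * Complex.exp (ω * Complex.I) : ℂ) :=
    (by fun_prop : Continuous fun ω : ℝ => (r * Complex.exp (ω * Complex.I) : ℂ)).measurable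
  exact (by fun_prop : Measurable fun ω : ℝ => n * ω).add
    (Complex.measurable_arg.comp ((measurable_leadRatio n a).comp h))

theorem circlePhase_add_two_pi (n : ℕ) (a : ℕ → ℂ) (r ω : ℝ) :
    circlePhase n a r (ω + 2 * Real.pi) = circlePhase n a r ω + (2 * n : ℕ) * Real.pi := by
  have h : Complex.exp ((ω + 2 * Real.pi : ℝ) * Complex.I) = Complex.exp (ω * Complex.I) := by
    push_cast
    rw [add_mul, Complex.exp_add, Complex.exp_two_pi_mul_I, mul_one]
  rw [circlePhase, circlePhase, h]
  push_cast
  ring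

theorem abs_circlePhase_le (n : ℕ) (a : ℕ → ℂ) (r ω : ℝ) :
    |circlePhase n a r ω| ≤ Real.pi + n * |ω| := by
  rw [circlePhase]
  refine (abs_add_le _ _).trans ?_
  rw [abs_mul, Nat.abs_cast, add_comm]
  gcongr
  exact Complex.abs_arg_le_pi _

theorem intervalIntegrable_crossIndex_circlePhase (n : ℕ) (a : ℕ → ℂ) (r γ s t : ℝ) :
    IntervalIntegrable (fun α => (crossIndex (circlePhase n a r (α + γ)) : ℝ)) volume s t := by
  refine intervalIntegrable_crossIndex ((measurable_circlePhase n a r).comp (by fun_prop))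
    (B := Real.pi + n * |γ|) (D := n) (fun x => ?_) s t
  refine (abs_circlePhase_le n a r (x + γ)).trans ?_
  have := mul_le_mul_of_nonneg_left (abs_add_le x γ) (Nat.cast_nonneg (α := ℝ) n)
  linarith

theorem intervalIntegrable_crossIndex_linear (n : ℕ) (γ s t : ℝ) :
    IntervalIntegrable (fun α => (crossIndex (n * (α + γ)) : ℝ)) volume s t := by
  refine intervalIntegrable_crossIndex (by fun_prop) (B := n * |γ|) (D := n) (fun x => ?_) s t
  rw [abs_mul, Nat.abs_cast]
  have := mul_le_mul_of_nonneg_left (abs_add_le x γ) (Nat.cast_nonneg (α := ℝ) n)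
  linarith

/-- Subtracting `crossIndex (n * ω)` leaves a `2π`-periodic function, whose mean ignores the shift;
the linear part accounts for `2 * (n * γ)`. -/
theorem integral_crossIndex_circlePhase {n : ℕ} (hn : n ≠ 0) (a : ℕ → ℂ) (r γ : ℝ) :
    ∫ α in (0 : ℝ)..2 * Real.pi, (crossIndex (circlePhase n a r (α + γ)) : ℝ) =
      (∫ α in (0 : ℝ)..2 * Real.pi, (crossIndex (circlePhase n a r α) : ℝ)) + 2 * (n * γ) := by
  set G : ℝ → ℝ := fun ω => (crossIndex (circlePhase n a r ω) : ℝ) - crossIndex (n * ω) with hG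
  have hper : Function.Periodic G (2 * Real.pi) := by
    intro ω
    have h2 : (n * (ω + 2 * Real.pi) : ℝ) = n * ω + (2 * n : ℕ) * Real.pi := by
      push_cast
      ring
    simp only [hG]
    rw [circlePhase_add_two_pi, h2, crossIndex_add_nat_mul_pi, crossIndex_add_nat_mul_pi]
    push_cast
    ring
  have key : ∀ γ : ℝ, ∫ α in (0 : ℝ)..2 * Real.pi, (crossIndex (circlePhase n a r (α + γ)) : ℝ) =
      (∫ α in (0 : ℝ)..2 * Real.pi, G α) + (2 * Real.pi * n + 2 * (n * γ)) := by
    intro γ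
    have h1 : ∀ α : ℝ, (crossIndex (circlePhase n a r (α + γ)) : ℝ) =
        G (α + γ) + crossIndex (n * (α + γ)) := by
      intro α
      simp only [hG]
      ring
    have hi1 : IntervalIntegrable (fun α => G (α + γ)) volume 0 (2 * Real.pi) :=
      (intervalIntegrable_crossIndex_circlePhase n a r γ _ _).sub
        (intervalIntegrable_crossIndex_linear n γ _ _)
    simp only [h1]
    rw [intervalIntegral.integral_add hi1 (intervalIntegrable_crossIndex_linear n γ _ _),
      intervalIntegral.integral_comp_add_right G, zero_add, add_comm (2 * Real.pi) γ,
      hper.intervalIntegral_add_eq γ 0, zero_add, ← integral_crossIndex hn (n * γ)]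
    simp only [mul_add]
  have h0 := key 0
  simp only [add_zero, mul_zero] at h0
  rw [key γ, h0]
  ring

theorem natAbs_crossIndex_sub (x y : ℝ) :
    (((crossIndex x - crossIndex y).natAbs : ℕ) : ℝ) = |(crossIndex x : ℝ) - crossIndex y| := by
  rw [Nat.cast_natAbs]
  push_cast
  rfl

theorem intervalIntegrable_outerCount (n : ℕ) (a : ℕ → ℂ) (r d s t : ℝ) :
    IntervalIntegrable (fun α => (outerCount n a r α d : ℝ)) volume s t := by
  simp only [outerCount, Nat.cast_add, natAbs_crossIndex_sub, sub_eq_add_neg _ (Real.pi / 2),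
    sub_eq_add_neg _ (Real.arccos _)]
  exact ((intervalIntegrable_crossIndex_linear n _ s t).sub
    (intervalIntegrable_crossIndex_circlePhase n a r _ s t)).abs.add
    ((intervalIntegrable_crossIndex_linear n _ s t).sub
    (intervalIntegrable_crossIndex_circlePhase n a r _ s t)).abs

theorem le_integral_outerCount {n : ℕ} (hn : n ≠ 0) (a : ℕ → ℂ) (r d : ℝ) :
    4 * n * |Real.arcsin (d / r)| ≤ ∫ α in (0 : ℝ)..2 * Real.pi, (outerCount n a r α d : ℝ) := by
  have h2π : (0 : ℝ) ≤ 2 * Real.pi := by positivity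
  set β := Real.arccos (d / r) with hβ
  have hsin : Real.arcsin (d / r) = Real.pi / 2 - β := by
    rw [hβ, Real.arccos]
    ring
  -- The signed crossings of the two rays are subtracted so that the unknown mean of `crossIndex`
  -- along the circle cancels.
  set H : ℝ → ℝ := fun α => ((crossIndex (n * (α + Real.pi / 2)) : ℝ) -
      crossIndex (circlePhase n a r (α + β))) - ((crossIndex (n * (α + -(Real.pi / 2))) : ℝ) -
      crossIndex (circlePhase n a r (α + -β))) with hH
  have i1 := intervalIntegrable_crossIndex_linear n (Real.pi / 2) 0 (2 * Real.pi)
  have i2 := intervalIntegrable_crossIndex_linear n (-(Real.pi / 2)) 0 (2 * Real.pi)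
  have i3 := intervalIntegrable_crossIndex_circlePhase n a r β 0 (2 * Real.pi)
  have i4 := intervalIntegrable_crossIndex_circlePhase n a r (-β) 0 (2 * Real.pi)
  have hHi : IntervalIntegrable H volume 0 (2 * Real.pi) := (i1.sub i3).sub (i2.sub i4)
  have hlin : ∀ γ : ℝ, ∫ α in (0 : ℝ)..2 * Real.pi, (crossIndex (n * (α + γ)) : ℝ) =
      2 * Real.pi * n + 2 * (n * γ) := by
    intro γ
    rw [← integral_crossIndex hn (n * γ)]
    simp only [mul_add]
  have hHint : ∫ α in (0 : ℝ)..2 * Real.pi, H α = 4 * n * Real.arcsin (d / r) := by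
    simp only [hH]
    rw [intervalIntegral.integral_sub (i1.sub i3) (i2.sub i4), intervalIntegral.integral_sub i1 i3,
      intervalIntegral.integral_sub i2 i4, hlin, hlin, integral_crossIndex_circlePhase hn a r β,
      integral_crossIndex_circlePhase hn a r (-β), hsin]
    ring
  have hle : ∀ α, |H α| ≤ (outerCount n a r α d : ℝ) := by
    intro α
    simp only [outerCount, Nat.cast_add, natAbs_crossIndex_sub, hH, ← sub_eq_add_neg]
    exact abs_sub _ _
  calc 4 * n * |Real.arcsin (d / r)| = |∫ α in (0 : ℝ)..2 * Real.pi, H α| := by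
        rw [hHint, abs_mul, abs_mul, Nat.abs_cast]
        norm_num
    _ ≤ ∫ α in (0 : ℝ)..2 * Real.pi, |H α| := intervalIntegral.abs_integral_le_integral_abs h2π
    _ ≤ _ := intervalIntegral.integral_mono_on h2π hHi.abs
        (intervalIntegrable_outerCount n a r d _ _) fun α _ => hle α

theorem integral_arcsin_unit : ∫ x in (0 : ℝ)..1, Real.arcsin x = Real.pi / 2 - 1 := by
  have h := intervalIntegral.integral_eq_sub_of_hasDerivAt_of_le (a := 0) (b := 1)
    (f := fun x => x * Real.arcsin x + √(1 - x ^ 2)) (f' := Real.arcsin) zero_le_one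
    (by
      have := Real.continuous_arcsin
      exact Continuous.continuousOn (by fun_prop))
    (fun x hx => by
      have hx1 : x ≠ -1 := by linarith [hx.1]
      have hx2 : x ≠ 1 := hx.2.ne
      have hpos : 0 < 1 - x ^ 2 := by nlinarith [hx.1, hx.2]
      have h1 := (hasDerivAt_id x).mul (Real.hasDerivAt_arcsin hx1 hx2)
      have h2 := (((hasDerivAt_id x).pow 2).const_sub 1).sqrt hpos.ne'
      refine (h1.add h2).congr_deriv ?_
      simp only [Pi.pow_apply, id, Nat.cast_ofNat]
      have hs : √(1 - x ^ 2) ≠ 0 := (Real.sqrt_pos.2 hpos).ne'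
      field_simp
      ring)
    (Real.continuous_arcsin.intervalIntegrable 0 1)
  rw [h]
  simp

theorem integral_abs_arcsin_div {r : ℝ} (hr : 0 < r) :
    ∫ d in (-r)..r, |Real.arcsin (d / r)| = r * (Real.pi - 2) := by
  have hc : Continuous fun x => |Real.arcsin x| := Real.continuous_arcsin.abs
  rw [intervalIntegral.integral_comp_div (fun x => |Real.arcsin x|) hr.ne', neg_div,
    div_self hr.ne', ← intervalIntegral.integral_add_adjacent_intervals
      (hc.intervalIntegrable (-1) 0) (hc.intervalIntegrable 0 1)]
  have h1 : ∫ x in (0 : ℝ)..1, |Real.arcsin x| = Real.pi / 2 - 1 := by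
    rw [← integral_arcsin_unit]
    refine intervalIntegral.integral_congr fun x hx => ?_
    rw [Set.uIcc_of_le zero_le_one] at hx
    exact abs_of_nonneg (Real.arcsin_nonneg.2 hx.1)
  have h2 : ∫ x in (-1 : ℝ)..0, |Real.arcsin x| = Real.pi / 2 - 1 := by
    rw [← h1]
    have := intervalIntegral.integral_comp_neg (a := (0 : ℝ)) (b := 1) (fun x => |Real.arcsin x|)
    simp only [Real.arcsin_neg, abs_neg, neg_zero] at this
    exact this.symm
  rw [h1, h2, smul_eq_mul]
  ring

/-! ### Length and defective lines -/

/-- For each fixed `w` the inequality is strict between continuous functions, jointly in the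
coefficients and the line. -/
theorem isOpen_lineDefective (n : ℕ) :
    IsOpen {x : (ℕ → ℂ) × ℝ × ℝ | lineDefective n x.1 x.2.1 x.2.2} := by
  have h : {x : (ℕ → ℂ) × ℝ × ℝ | lineDefective n x.1 x.2.1 x.2.2} =
      ⋃ w : ℂ, {x | ‖(linePoly n x.1 x.2.1 x.2.2).eval w‖ <
        |Real.cos (n * (x.2.1 + Real.pi / 2))| * |w.im| ^ n} := by
    ext x
    simp [lineDefective]
  rw [h]
  refine isOpen_iUnion fun w => isOpen_lt ?_ (by fun_prop)
  have hp : ∀ w : ℂ, Continuous fun x : (ℕ → ℂ) × ℝ × ℝ =>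
      (centeredPoly n x.1).eval (linePoint x.2.1 x.2.2 w) := by
    intro w
    simp only [eval_centeredPoly, linePoint]
    fun_prop
  simp only [eval_linePoly]
  exact (continuous_const.mul ((hp w).add (Complex.continuous_conj.comp (hp (conj w))))).norm

/-- The set of defective lines, in the coordinates direction and distance. -/
def defectSet (n : ℕ) (a : ℕ → ℂ) : Set (ℝ × ℝ) := {x | lineDefective n a x.1 x.2}

theorem isOpen_defectSet (n : ℕ) (a : ℕ → ℂ) : IsOpen (defectSet n a) :=
  (isOpen_lineDefective n).preimage (Continuous.prodMk_right a)

theorem measurable_outerCount (n : ℕ) (a : ℕ → ℂ) (r : ℝ) :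
    Measurable fun x : ℝ × ℝ => (outerCount n a r x.1 x.2 : ℝ) := by
  have hcast : Measurable fun m : ℤ => (m : ℝ) := measurable_from_top
  have hlin : ∀ γ : ℝ, Measurable fun x : ℝ × ℝ => (crossIndex (n * (x.1 + γ)) : ℝ) := fun γ =>
    hcast.comp (measurable_crossIndex.comp (by fun_prop))
  have hacos : Measurable fun x : ℝ × ℝ => Real.arccos (x.2 / r) :=
    Real.continuous_arccos.measurable.comp (by fun_prop)
  have hcirc : ∀ f : ℝ × ℝ → ℝ, Measurable f →
      Measurable fun x => (crossIndex (circlePhase n a r (f x)) : ℝ) := fun f hf =>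
    hcast.comp (measurable_crossIndex.comp ((measurable_circlePhase n a r).comp hf))
  simp only [outerCount, Nat.cast_add, natAbs_crossIndex_sub, sub_eq_add_neg _ (Real.pi / 2)]
  exact ((hlin _).sub (hcirc _ (measurable_fst.add hacos))).abs.add
    ((hlin _).sub (hcirc _ (measurable_fst.sub hacos))).abs

theorem ae_cos_ne_zero {n : ℕ} (hn : n ≠ 0) :
    ∀ᵐ α : ℝ, Real.cos (n * (α + Real.pi / 2)) ≠ 0 := by
  have hn' : (n : ℝ) ≠ 0 := by exact_mod_cast hn
  have hsub : {α : ℝ | Real.cos (n * (α + Real.pi / 2)) = 0} ⊆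
      Set.range fun k : ℤ => (2 * (k : ℝ) + 1) * Real.pi / 2 / n - Real.pi / 2 := by
    intro α hα
    obtain ⟨k, hk⟩ := Real.cos_eq_zero_iff.1 hα
    refine ⟨k, ?_⟩
    simp only
    rw [← hk]
    field_simp
    ring
  have h0 := ((Set.countable_range _).mono hsub).measure_zero volume
  rw [ae_iff]
  simpa using h0

open Classical in
theorem four_mul_hausdorffMeasure_reZeroSet_le {n : ℕ} (hn : 2 ≤ n) {a : ℕ → ℂ}
    (ha : ∀ k ∈ Finset.Icc 2 n, ‖a k‖ ≤ 1) {r : ℝ} (hr : 2 ≤ r) :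
    4 * Measure.hausdorffMeasure 1 (reZeroSet (centeredPoly n a) ∩ Metric.ball 0 r) ≤
      ENNReal.ofReal (8 * n * r - ((volume.restrict (Set.Ioc 0 (2 * Real.pi))).prod
        (volume.restrict (Set.Ioo (-r) r))).real (defectSet n a)) := by
  have hr0 : 0 < r := by linarith
  have h2π : (0 : ℝ) ≤ 2 * Real.pi := by positivity
  have hn0 : n ≠ 0 := by omega
  set μ := volume.restrict (Set.Ioc 0 (2 * Real.pi)) with hμ
  set ν := volume.restrict (Set.Ioo (-r) r) with hν
  set S := reZeroSet (centeredPoly n a) ∩ Metric.ball 0 r with hS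
  set D := defectSet n a with hD
  have hDm : MeasurableSet D := (isOpen_defectSet n a).measurableSet
  set W : ℝ × ℝ → ℝ := fun x => n - outerCount n a r x.1 x.2 - D.indicator 1 x with hW
  have hWm : Measurable W := ((measurable_const.sub (measurable_outerCount n a r)).sub
    (measurable_one.indicator hDm))
  have hcount : ∀ α, Real.cos (n * (α + Real.pi / 2)) ≠ 0 → ∀ d, |d| < r → ∀ Z : Finset ℂ,
      (∀ z ∈ Z, z ∈ S ∧ lineCoord α z = d) → (Z.card : ℝ) ≤ W (α, d) := by
    intro α hα d hd Z hZ
    have h := card_add_outerCount_le hn ha hr hd hα Z hZ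
    have h' : (Z.card : ℝ) + outerCount n a r α d + (if lineDefective n a α d then 1 else 0) ≤ n := by
      exact_mod_cast h
    have h2 : D.indicator (1 : ℝ × ℝ → ℝ) (α, d) = if lineDefective n a α d then 1 else 0 := rfl
    simp only [hW, h2]
    linarith
  have hae : ∀ᵐ x ∂μ.prod ν, Real.cos (n * (x.1 + Real.pi / 2)) ≠ 0 ∧ |x.2| < r := by
    have h1 : ∀ᵐ α ∂μ, Real.cos (n * (α + Real.pi / 2)) ≠ 0 :=
      ae_restrict_of_ae (ae_cos_ne_zero hn0)
    have h2 : ∀ᵐ d ∂ν, |d| < r := by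
      filter_upwards [ae_restrict_mem measurableSet_Ioo] with d hd
      exact abs_lt.2 hd
    exact (Measure.quasiMeasurePreserving_fst.ae h1).and
      (Measure.quasiMeasurePreserving_snd.ae h2)
  -- The empty set of zeros already gives nonnegativity, which in turn bounds `outerCount` by `n`
  -- and makes it integrable.
  have hW0 : ∀ᵐ x ∂μ.prod ν, 0 ≤ W x := by
    filter_upwards [hae] with x hx
    simpa using hcount x.1 hx.1 x.2 hx.2 ∅ (by simp)
  have houter : Integrable (fun x : ℝ × ℝ => (outerCount n a r x.1 x.2 : ℝ)) (μ.prod ν) := by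
    refine Integrable.of_bound (measurable_outerCount n a r).aestronglyMeasurable n ?_
    filter_upwards [hW0] with x hx
    have h1 : 0 ≤ D.indicator (1 : ℝ × ℝ → ℝ) x := Set.indicator_nonneg (fun _ _ => zero_le_one) x
    rw [Real.norm_of_nonneg (Nat.cast_nonneg _)]
    simp only [hW] at hx
    linarith
  have hDi : Integrable (D.indicator (1 : ℝ × ℝ → ℝ)) (μ.prod ν) :=
    (integrable_const (1 : ℝ)).indicator hDm
  have hWi : Integrable W (μ.prod ν) := ((integrable_const _).sub houter).sub hDi
  have hp : (centeredPoly n a).derivative ≠ 0 := by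
    intro h0
    have := derivative_eq_zero.1 h0
    rw [natDegree_centeredPoly hn] at this
    omega
  have hSm : MeasurableSet S := by
    refine MeasurableSet.inter ?_ measurableSet_ball
    exact (isClosed_eq (Complex.continuous_re.comp (centeredPoly n a).continuous)
      continuous_const).measurableSet
  have hcrofton := four_mul_hausdorffMeasure_le hp hSm Set.inter_subset_left
    (g := fun α d => (Set.Ioo (-r) r).indicator (fun d => ENNReal.ofReal (W (α, d))) d) (by
      filter_upwards [ae_restrict_of_ae (ae_cos_ne_zero hn0)] with α hα d Z hZ
      by_cases hd : d ∈ Set.Ioo (-r) r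
      · rw [Set.indicator_of_mem hd]
        have h := hcount α hα d (abs_lt.2 hd) Z hZ
        rw [← ENNReal.ofReal_natCast]
        exact ENNReal.ofReal_le_ofReal h
      · have hZ0 : Z = ∅ := by
          refine Finset.eq_empty_of_forall_notMem fun z hz => hd ?_
          obtain ⟨⟨_, hzr⟩, hzd⟩ := hZ z hz
          have hzr' : ‖z‖ < r := by simpa using hzr
          have h := lineCoord_sq_add_lineParam_sq α z
          rw [hzd] at h
          exact abs_lt.1 (lt_of_le_of_lt (abs_le_of_sq_le_sq (by nlinarith) (norm_nonneg z)) hzr')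
        simp [hZ0])
  simp only [lintegral_indicator measurableSet_Ioo] at hcrofton
  rw [← lintegral_prod _ hWm.ennreal_ofReal.aemeasurable,
    ← ofReal_integral_eq_lintegral_ofReal hWi hW0] at hcrofton
  refine hcrofton.trans (ENNReal.ofReal_le_ofReal ?_)
  have hmass : (μ.prod ν).real Set.univ = 2 * Real.pi * (2 * r) := by
    rw [measureReal_def, ← Set.univ_prod_univ, Measure.prod_prod, hμ, hν, Measure.restrict_apply_univ,
      Measure.restrict_apply_univ, Real.volume_Ioc, Real.volume_Ioo, ENNReal.toReal_mul,
      ENNReal.toReal_ofReal (by linarith), ENNReal.toReal_ofReal (by linarith)]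
    ring
  have hI : ∫ x, W x ∂μ.prod ν = n * (4 * Real.pi * r) -
      (∫ x, (outerCount n a r x.1 x.2 : ℝ) ∂μ.prod ν) - (μ.prod ν).real D := by
    have hNi : Integrable (fun x : ℝ × ℝ => (n : ℝ) - outerCount n a r x.1 x.2) (μ.prod ν) :=
      (integrable_const _).sub houter
    simp only [hW]
    rw [integral_sub hNi hDi,
      integral_sub (integrable_const _) houter, integral_const, hmass, integral_indicator_one hDm,
      smul_eq_mul]
    ring
  have hO : 4 * n * (r * (Real.pi - 2)) ≤ ∫ x, (outerCount n a r x.1 x.2 : ℝ) ∂μ.prod ν := by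
    rw [integral_prod_symm _ houter, ← integral_abs_arcsin_div hr0,
      intervalIntegral.integral_of_le (by linarith), ← integral_const_mul,
      integral_Ioc_eq_integral_Ioo]
    refine integral_mono_ae ?_ houter.integral_prod_right (ae_of_all _ fun d => ?_)
    · have hc : Continuous fun d : ℝ => 4 * n * |Real.arcsin (d / r)| := by
        have := Real.continuous_arcsin
        fun_prop
      exact hc.integrableOn_Icc.mono_set Set.Ioo_subset_Icc_self
    · have := le_integral_outerCount hn0 a r d
      rwa [intervalIntegral.integral_of_le h2π] at this
  -- The main terms combine as `4πnr - 4nr(π - 2) = 8nr`.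
  rw [hI]
  linarith

/-! ### Existence and abundance of defective lines -/

theorem Multiset.esymm_one_eq_sum {R : Type*} [CommSemiring R] (s : Multiset R) :
    s.esymm 1 = s.sum := by
  simp [Multiset.esymm, Multiset.powersetCard_one]

theorem Multiset.two_mul_esymm_two {R : Type*} [CommRing R] (s : Multiset R) :
    2 * s.esymm 2 = s.sum ^ 2 - (s.map (fun t => t ^ 2)).sum := by
  induction s using Multiset.induction with
  | empty => simp [Multiset.esymm, Multiset.powersetCard_zero_right]
  | cons t s ih =>
    have h : (t ::ₘ s).esymm 2 = s.esymm 2 + t * s.sum := by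
      rw [← Multiset.esymm_one_eq_sum]
      simp only [Multiset.esymm, Multiset.powersetCard_cons, Multiset.map_add, Multiset.sum_add,
        Multiset.map_map, Function.comp_def, Multiset.prod_cons, Multiset.sum_map_mul_left]
    rw [h, mul_add, ih, Multiset.sum_cons, Multiset.map_cons, Multiset.sum_cons]
    ring

theorem Multiset.sum_map_sq_re {s : Multiset ℂ} (hs : ∀ t ∈ s, t.im = 0) :
    (s.map (fun t => t ^ 2)).sum = (((s.map (fun t => t.re ^ 2)).sum : ℝ) : ℂ) := by
  induction s using Multiset.induction with
  | empty => simp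
  | cons t s ih =>
    have ht : t = (t.re : ℂ) := Complex.ext rfl (by simpa using hs t (Multiset.mem_cons_self t s))
    rw [Multiset.map_cons, Multiset.sum_cons, Multiset.map_cons, Multiset.sum_cons,
      ih fun x hx => hs x (Multiset.mem_cons_of_mem hx)]
    conv_lhs => rw [ht]
    push_cast
    ring

/-- The coefficients of `Re p` along the line through the origin with direction `exp (φ * I)`. -/
noncomputable def rayCoeff (n : ℕ) (a : ℕ → ℂ) (φ : ℝ) (k : ℕ) : ℝ :=
  (a k * Complex.exp (φ * Complex.I) ^ (n - k)).re

/-- A line with direction angle `φ` has normal angle `φ - π / 2`. With `d = 0` no powers mix, so the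
gap below `X ^ n` survives restriction. -/
theorem linePoly_through_zero (n : ℕ) (a : ℕ → ℂ) (φ : ℝ) :
    linePoly n a (φ - Real.pi / 2) 0 = C (Real.cos (n * φ) : ℂ) * X ^ n +
      ∑ k ∈ Finset.Icc 2 n, C (rayCoeff n a φ k : ℂ) * X ^ (n - k) := by
  have hpt : ∀ w : ℂ, linePoint (φ - Real.pi / 2) 0 w = Complex.exp (φ * Complex.I) * w := by
    intro w
    have h : Complex.exp ((φ - Real.pi / 2 : ℝ) * Complex.I) * Complex.I =
        Complex.exp (φ * Complex.I) := by
      nth_rewrite 2 [← Complex.exp_pi_div_two_mul_I]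
      rw [← Complex.exp_add]
      congr 1
      push_cast
      ring
    rw [linePoint, ← h, Complex.ofReal_zero]
    ring
  have hcos : (Real.cos (n * φ) : ℂ) = 1 / 2 *
      (Complex.exp (φ * Complex.I) ^ n + conj (Complex.exp (φ * Complex.I) ^ n)) := by
    have h : Complex.exp (φ * Complex.I) ^ n = Complex.exp ((n * φ : ℝ) * Complex.I) := by
      rw [← Complex.exp_nat_mul]
      congr 1
      push_cast
      ring
    rw [h, Complex.add_conj, Complex.exp_ofReal_mul_I_re]
    push_cast
    ring
  have hray : ∀ k, (rayCoeff n a φ k : ℂ) = 1 / 2 * (a k * Complex.exp (φ * Complex.I) ^ (n - k) +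
      conj (a k * Complex.exp (φ * Complex.I) ^ (n - k))) := by
    intro k
    rw [Complex.add_conj, rayCoeff]
    push_cast
    ring
  refine Polynomial.funext fun w => ?_
  rw [eval_linePoly, hpt, hpt, eval_centeredPoly, eval_centeredPoly, eval_add, eval_mul, eval_C,
    eval_pow, eval_X, eval_finsetSum, hcos]
  simp only [eval_mul, eval_C, eval_pow, eval_X]
  simp only [hray, map_add, map_sum, map_mul, map_pow,
    Complex.conj_conj]
  rw [add_add_add_comm, ← Finset.sum_add_distrib, mul_add, Finset.mul_sum]
  congr 1
  · ring
  · refine Finset.sum_congr rfl fun k _ => ?_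
    ring

theorem coeff_linePoly_through_zero {n : ℕ} (a : ℕ → ℂ) (φ : ℝ) {k : ℕ}
    (hk : k ∈ Finset.Icc 2 n) :
    (linePoly n a (φ - Real.pi / 2) 0).coeff (n - k) = (rayCoeff n a φ k : ℂ) := by
  have hk' := Finset.mem_Icc.1 hk
  rw [linePoly_through_zero, coeff_add, coeff_C_mul, coeff_X_pow, if_neg (by omega), mul_zero,
    zero_add, finsetSum_coeff, Finset.sum_eq_single k]
  · simp
  · intro j hj hjk
    have hj' := Finset.mem_Icc.1 hj
    rw [coeff_C_mul, coeff_X_pow, if_neg (by omega), mul_zero]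
  · exact fun h => absurd hk h

theorem coeff_pred_linePoly_through_zero {n : ℕ} (hn : 2 ≤ n) (a : ℕ → ℂ) (φ : ℝ) :
    (linePoly n a (φ - Real.pi / 2) 0).coeff (n - 1) = 0 := by
  rw [linePoly_through_zero, coeff_add, coeff_C_mul, coeff_X_pow, if_neg (by omega), mul_zero,
    zero_add, finsetSum_coeff]
  refine Finset.sum_eq_zero fun j hj => ?_
  have hj' := Finset.mem_Icc.1 hj
  rw [coeff_C_mul, coeff_X_pow, if_neg (by omega), mul_zero]

theorem cos_mul_sub_add_half_pi (n : ℕ) (φ : ℝ) :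
    Real.cos (n * (φ - Real.pi / 2 + Real.pi / 2)) = Real.cos (n * φ) := by
  rw [sub_add_cancel]

/-- Newton's identity for the squares of the roots on a line through the origin that is not
defective. -/
theorem cos_mul_sum_sq_roots {n : ℕ} (hn : 2 ≤ n) {a : ℕ → ℂ} {φ : ℝ}
    (hφ : Real.cos (n * φ) ≠ 0) (hnd : ¬ lineDefective n a (φ - Real.pi / 2) 0) :
    Real.cos (n * φ) * ((linePoly n a (φ - Real.pi / 2) 0).roots.map (fun t => t.re ^ 2)).sum =
      -2 * rayCoeff n a φ 2 := by
  have hφ' : Real.cos (n * (φ - Real.pi / 2 + Real.pi / 2)) ≠ 0 := by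
    rwa [cos_mul_sub_add_half_pi]
  set s := (linePoly n a (φ - Real.pi / 2) 0).roots with hs
  have hreal : ∀ t ∈ s, t.im = 0 := by
    intro t ht
    by_contra him
    exact hnd (lineDefective_of_root hφ' ht him)
  have hcard : s.card = n := by
    rw [hs, IsAlgClosed.card_roots_eq_natDegree, natDegree_linePoly hn a 0 hφ']
  have hprod := linePoly_eq_prod hn a 0 hφ'
  rw [cos_mul_sub_add_half_pi, ← hs] at hprod
  have hc : (Real.cos (n * φ) : ℂ) ≠ 0 := by exact_mod_cast hφ
  have h1 := coeff_pred_linePoly_through_zero hn a φ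
  rw [hprod, coeff_C_mul, Multiset.prod_X_sub_C_coeff s (by omega), hcard,
    show n - (n - 1) = 1 by omega, Multiset.esymm_one_eq_sum] at h1
  have hsum : s.sum = 0 := by
    have h := (mul_eq_zero.1 h1).resolve_left hc
    rwa [pow_one, neg_one_mul, neg_eq_zero] at h
  have h2 := coeff_linePoly_through_zero a φ (Finset.mem_Icc.2 ⟨le_refl 2, hn⟩)
  rw [hprod, coeff_C_mul, Multiset.prod_X_sub_C_coeff s (by omega), hcard,
    show n - (n - 2) = 2 by omega] at h2
  have h3 := Multiset.two_mul_esymm_two s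
  rw [hsum, Multiset.sum_map_sq_re hreal] at h3
  have h4 : ((Real.cos (n * φ) * (s.map (fun t => t.re ^ 2)).sum : ℝ) : ℂ) =
      ((-2 * rayCoeff n a φ 2 : ℝ) : ℂ) := by
    push_cast at h2 h3 ⊢
    linear_combination (-2 : ℂ) * h2 + Complex.cos (n * φ) * h3
  exact_mod_cast h4

/-- Real roots have a nonnegative sum of squares; multiplying Newton's identity by the cosine
removes the unknown sign of the leading coefficient. -/
theorem cos_mul_rayCoeff_two_nonpos {n : ℕ} (hn : 2 ≤ n) {a : ℕ → ℂ} {φ : ℝ}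
    (hnd : ¬ lineDefective n a (φ - Real.pi / 2) 0) :
    Real.cos (n * φ) * rayCoeff n a φ 2 ≤ 0 := by
  by_cases hφ : Real.cos (n * φ) = 0
  · rw [hφ, zero_mul]
  · have h := cos_mul_sum_sq_roots hn hφ hnd
    have h0 : 0 ≤ ((linePoly n a (φ - Real.pi / 2) 0).roots.map (fun t => t.re ^ 2)).sum :=
      Multiset.sum_nonneg (by
        intro x hx
        obtain ⟨t, _, rfl⟩ := Multiset.mem_map.1 hx
        positivity)
    have h1 := mul_nonneg (sq_nonneg (Real.cos (n * φ))) h0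
    rw [sq, mul_assoc, h] at h1
    linarith

/-- The squares of the real roots sum to zero, so all roots vanish and the line polynomial is a
multiple of `X ^ n`. -/
theorem rayCoeff_eq_zero_of_rayCoeff_two {n : ℕ} (hn : 2 ≤ n) {a : ℕ → ℂ} {φ : ℝ}
    (hφ : Real.cos (n * φ) ≠ 0) (hnd : ¬ lineDefective n a (φ - Real.pi / 2) 0)
    (h2 : rayCoeff n a φ 2 = 0) {k : ℕ} (hk : k ∈ Finset.Icc 2 n) : rayCoeff n a φ k = 0 := by
  have hφ' : Real.cos (n * (φ - Real.pi / 2 + Real.pi / 2)) ≠ 0 := by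
    rwa [cos_mul_sub_add_half_pi]
  have h := cos_mul_sum_sq_roots hn hφ hnd
  rw [h2, mul_zero] at h
  have hsum := (mul_eq_zero.1 h).resolve_left hφ
  set s := (linePoly n a (φ - Real.pi / 2) 0).roots with hs
  have hzero : ∀ t ∈ s, t = 0 := by
    intro t ht
    have hle := Multiset.single_le_sum (s := s.map (fun t => t.re ^ 2)) (by
        intro x hx
        obtain ⟨t, _, rfl⟩ := Multiset.mem_map.1 hx
        positivity) _ (Multiset.mem_map_of_mem _ ht)
    rw [hsum] at hle
    have hre : t.re = 0 := by nlinarith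
    have him : t.im = 0 := by
      by_contra him
      exact hnd (lineDefective_of_root hφ' ht him)
    exact Complex.ext hre him
  have hcard : s.card = n := by
    rw [hs, IsAlgClosed.card_roots_eq_natDegree, natDegree_linePoly hn a 0 hφ']
  have hrep : s = Multiset.replicate n 0 := Multiset.eq_replicate.2 ⟨hcard, hzero⟩
  have hprod := linePoly_eq_prod hn a 0 hφ'
  rw [← hs, hrep, Multiset.map_replicate, Multiset.prod_replicate, C_0, sub_zero] at hprod
  have hk' := Finset.mem_Icc.1 hk
  have hco := coeff_linePoly_through_zero a φ hk
  rw [hprod, coeff_C_mul, coeff_X_pow, if_neg (by omega), mul_zero] at hco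
  exact_mod_cast hco.symm

/-- Rotation by `jπ / n` multiplies the cosine by `(-1) ^ j` and the complex coefficient by `(-1) ^
j * ζ ^ j`. The signs cancel, leaving a vanishing sum of powers of a primitive `n`-th root of unity.
-/
theorem sum_cos_mul_rayCoeff_two {n : ℕ} (hn : 2 ≤ n) (a : ℕ → ℂ) (φ : ℝ) :
    ∑ j ∈ Finset.range n, Real.cos (n * (φ + j * (Real.pi / n))) *
      rayCoeff n a (φ + j * (Real.pi / n)) 2 = 0 := by
  have hn0 : n ≠ 0 := by omega
  have hn' : (n : ℂ) ≠ 0 := by exact_mod_cast hn0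
  have hnR : (n : ℝ) ≠ 0 := by exact_mod_cast hn0
  set ζ := (Complex.exp (2 * Real.pi * Complex.I / n))⁻¹ with hζ
  have hprim : IsPrimitiveRoot ζ n := (Complex.isPrimitiveRoot_exp n hn0).inv
  have hgeom : ∑ j ∈ Finset.range n, ζ ^ j = 0 := hprim.geom_sum_eq_zero (by omega)
  set A := a 2 * Complex.exp (φ * Complex.I) ^ (n - 2) with hA
  have hterm : ∀ j : ℕ, Real.cos (n * (φ + j * (Real.pi / n))) *
      rayCoeff n a (φ + j * (Real.pi / n)) 2 = Real.cos (n * φ) * (A * ζ ^ j).re := by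
    intro j
    have h1 : (n * (φ + j * (Real.pi / n)) : ℝ) = n * φ + j * Real.pi := by
      field_simp
    have h2 : Complex.exp ((φ + j * (Real.pi / n) : ℝ) * Complex.I) ^ (n - 2) =
        Complex.exp (φ * Complex.I) ^ (n - 2) * ((-1) ^ j * ζ ^ j) := by
      have hcast : ((n - 2 : ℕ) : ℂ) = n - 2 := by push_cast [hn]; ring
      rw [hζ, ← Complex.exp_pi_mul_I, ← Complex.exp_neg, ← Complex.exp_nat_mul,
        ← Complex.exp_nat_mul, ← Complex.exp_nat_mul, ← Complex.exp_nat_mul, ← Complex.exp_add,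
        ← Complex.exp_add, hcast]
      congr 1
      push_cast
      field_simp
      ring
    rw [h1, Real.cos_add_nat_mul_pi, rayCoeff, h2]
    have h3 : a 2 * (Complex.exp (φ * Complex.I) ^ (n - 2) * ((-1) ^ j * ζ ^ j)) =
        (((-1) ^ j : ℝ) : ℂ) * (A * ζ ^ j) := by
      rw [hA]
      push_cast
      ring
    rw [h3, Complex.re_ofReal_mul]
    have h4 : ((-1 : ℝ) ^ j) * (-1) ^ j = 1 := by rw [← mul_pow]; norm_num
    linear_combination (Real.cos (n * φ) * (A * ζ ^ j).re) * h4
  rw [Finset.sum_congr rfl fun j _ => hterm j, ← Finset.mul_sum, ← Complex.re_sum,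
    ← Finset.mul_sum, hgeom, mul_zero, Complex.zero_re, mul_zero]

/-- Nonpositive terms with sum zero are all zero. -/
theorem rayCoeff_eq_zero {n : ℕ} (hn : 2 ≤ n) {a : ℕ → ℂ} {φ : ℝ} (hφ : Real.cos (n * φ) ≠ 0)
    (hnd : ∀ j ∈ Finset.range n, ¬ lineDefective n a (φ + j * (Real.pi / n) - Real.pi / 2) 0)
    {k : ℕ} (hk : k ∈ Finset.Icc 2 n) : rayCoeff n a φ k = 0 := by
  have h0 : 0 ∈ Finset.range n := Finset.mem_range.2 (by omega)
  have hsum := (Finset.sum_eq_zero_iff_of_nonpos fun j hj =>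
    cos_mul_rayCoeff_two_nonpos hn (hnd j hj)).1 (sum_cos_mul_rayCoeff_two hn a φ) 0 h0
  have hnd0 := hnd 0 h0
  simp only [Nat.cast_zero, zero_mul, add_zero] at hsum hnd0
  exact rayCoeff_eq_zero_of_rayCoeff_two hn hφ hnd0 ((mul_eq_zero.1 hsum).resolve_left hφ) hk

theorem exists_lineDefective {n : ℕ} (hn : 2 ≤ n) {a : ℕ → ℂ} (han : (a n).im = 0) {k : ℕ}
    (hk : k ∈ Finset.Icc 2 n) (hak : a k ≠ 0) :
    ∃ α ∈ Set.Ioo 0 (2 * Real.pi), lineDefective n a α 0 := by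
  by_contra! hnd
  have hπ := Real.pi_pos
  have hn0 : (0 : ℝ) < n := by exact_mod_cast (by omega : 0 < n)
  have hn2 : (2 : ℝ) ≤ n := by exact_mod_cast hn
  have hk' := Finset.mem_Icc.1 hk
  -- Two directions, `π` and `π + δ`, determine a complex coefficient with `k < n`. Here `n * δ = π
  -- / 4` keeps the cosine nonzero, and starting at `π` keeps all normal angles inside `(0, 2π)`.
  set δ := Real.pi / (4 * n) with hδ
  have hδ0 : 0 < δ := by positivity
  have hδn : n * δ = Real.pi / 4 := by rw [hδ]; field_simp
  have hray : ∀ θ : ℝ, 0 ≤ θ → θ ≤ δ → Real.cos (n * (Real.pi + θ)) ≠ 0 →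
      rayCoeff n a (Real.pi + θ) k = 0 := by
    intro θ h0 h1 hc
    refine rayCoeff_eq_zero hn hc (fun j hj => hnd _ ?_) hk
    have hj' : (j : ℝ) + 1 ≤ n := by exact_mod_cast Finset.mem_range.1 hj
    have hj0 : (0 : ℝ) ≤ j * (Real.pi / n) := by positivity
    have hj1 : j * (Real.pi / n) + Real.pi / n ≤ Real.pi := by
      calc j * (Real.pi / n) + Real.pi / n = (j + 1) * (Real.pi / n) := by ring
        _ ≤ n * (Real.pi / n) := by gcongr
        _ = Real.pi := by field_simp
    have hδπ : δ ≤ Real.pi / n := by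
      rw [hδ]
      gcongr
      linarith
    constructor <;> linarith
  have hcos : ∀ θ : ℝ, Real.cos (n * (Real.pi + θ)) = (-1) ^ n * Real.cos (n * θ) := by
    intro θ
    rw [mul_add, add_comm, Real.cos_add_nat_mul_pi]
  set A := a k * Complex.exp (Real.pi * Complex.I) ^ (n - k) with hA
  have hexp : ∀ θ : ℝ, rayCoeff n a (Real.pi + θ) k =
      A.re * Real.cos ((n - k : ℕ) * θ) - A.im * Real.sin ((n - k : ℕ) * θ) := by
    intro θ
    have h : Complex.exp ((Real.pi + θ : ℝ) * Complex.I) ^ (n - k) =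
        Complex.exp (Real.pi * Complex.I) ^ (n - k) *
          Complex.exp ((((n - k : ℕ) : ℝ) * θ : ℝ) * Complex.I) := by
      rw [← Complex.exp_nat_mul, ← Complex.exp_nat_mul, ← Complex.exp_add]
      congr 1
      push_cast
      ring
    rw [rayCoeff, h, ← mul_assoc, ← hA, Complex.mul_re, Complex.exp_ofReal_mul_I_re,
      Complex.exp_ofReal_mul_I_im]
  have hA0 : A.re = 0 := by
    have h := hray 0 le_rfl hδ0.le (by
      rw [hcos, mul_zero, Real.cos_zero, mul_one]
      exact pow_ne_zero _ (by norm_num))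
    rw [hexp] at h
    simpa using h
  -- The constant coefficient does not rotate with the direction, so its imaginary part is
  -- controlled only by the assumption that `a n` is real.
  rcases eq_or_lt_of_le hk'.2 with rfl | hlt
  · rw [hA, Nat.sub_self, pow_zero, mul_one] at hA0
    exact hak (Complex.ext hA0 han)
  · have h := hray δ hδ0.le le_rfl (by
      rw [hcos, hδn, Real.cos_pi_div_four]
      exact mul_ne_zero (pow_ne_zero _ (by norm_num)) (by positivity))
    rw [hexp, hA0, zero_mul, zero_sub, neg_eq_zero] at h
    have hm0 : (0 : ℝ) < (n - k : ℕ) := by exact_mod_cast (by omega : 0 < n - k)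
    have hmn : ((n - k : ℕ) : ℝ) ≤ n := by exact_mod_cast Nat.sub_le n k
    have hsin : 0 < Real.sin ((n - k : ℕ) * δ) := by
      apply Real.sin_pos_of_pos_of_lt_pi (by positivity)
      have := mul_le_mul_of_nonneg_right hmn hδ0.le
      linarith
    have hAim := (mul_eq_zero.1 h).resolve_right hsin.ne'
    have hAz : A = 0 := Complex.ext hA0 hAim
    rw [hA] at hAz
    exact hak ((mul_eq_zero.1 hAz).resolve_right (pow_ne_zero _ (Complex.exp_ne_zero _)))

/-- The normalised coefficient sequences. -/
def unitCoeffs (n : ℕ) : Set (ℕ → ℂ) :=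
  {a | (∀ k, ‖a k‖ ≤ 1) ∧ (a n).im = 0 ∧ ∃ k ∈ Finset.Icc 2 n, ‖a k‖ = 1}

theorem isCompact_unitCoeffs (n : ℕ) : IsCompact (unitCoeffs n) := by
  have hc : IsCompact (Set.univ.pi fun _ : ℕ => Metric.closedBall (0 : ℂ) 1) :=
    isCompact_univ_pi fun _ => isCompact_closedBall 0 1
  have h : unitCoeffs n = (Set.univ.pi fun _ : ℕ => Metric.closedBall (0 : ℂ) 1) ∩
      ({a | (a n).im = 0} ∩ ⋃ k ∈ Finset.Icc 2 n, {a | ‖a k‖ = 1}) := by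
    ext a
    simp [unitCoeffs]
  rw [h]
  refine hc.inter_right (IsClosed.inter ?_ ?_)
  · exact isClosed_eq (by fun_prop) continuous_const
  · exact isClosed_biUnion_finset fun k _ => isClosed_eq (by fun_prop) continuous_const

/-- Near each coefficient sequence one open set of lines stays defective; compactness makes the
lower bound uniform. -/
theorem exists_pos_le_measure_defectSet {n : ℕ} (hn : 2 ≤ n) :
    ∃ c : ℝ, 0 < c ∧ ∀ a ∈ unitCoeffs n, ∀ r : ℝ, 2 ≤ r →
      c ≤ ((volume.restrict (Set.Ioc 0 (2 * Real.pi))).prod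
        (volume.restrict (Set.Ioo (-r) r))).real (defectSet n a) := by
  refine (isCompact_unitCoeffs n).induction_on (p := fun K => ∃ c : ℝ, 0 < c ∧ ∀ a ∈ K, ∀ r : ℝ,
    2 ≤ r → c ≤ ((volume.restrict (Set.Ioc 0 (2 * Real.pi))).prod
        (volume.restrict (Set.Ioo (-r) r))).real (defectSet n a)) ?_ ?_ ?_ ?_
  · exact ⟨1, one_pos, fun a ha => absurd ha (Set.notMem_empty a)⟩
  · rintro s t hst ⟨c, hc, h⟩
    exact ⟨c, hc, fun a ha => h a (hst ha)⟩
  · rintro s t ⟨c, hc, h⟩ ⟨c', hc', h'⟩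
    refine ⟨min c c', lt_min hc hc', ?_⟩
    rintro a (ha | ha) r hr
    · exact (min_le_left _ _).trans (h a ha r hr)
    · exact (min_le_right _ _).trans (h' a ha r hr)
  · rintro a₀ ⟨_, ha₀n, k, hk, hak⟩
    obtain ⟨α, hα, hdef⟩ := exists_lineDefective hn ha₀n hk (by
      rintro h0
      rw [h0, norm_zero] at hak
      exact zero_ne_one hak)
    have hmem : {x : (ℕ → ℂ) × ℝ × ℝ | lineDefective n x.1 x.2.1 x.2.2} ∈ 𝓝 (a₀, (α, (0 : ℝ))) :=
      (isOpen_lineDefective n).mem_nhds hdef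
    rw [nhds_prod_eq] at hmem
    obtain ⟨U, hU, V, hV, hUV⟩ := mem_prod_iff.1 hmem
    obtain ⟨V₁, hV₁, hV₁o, hαV⟩ := mem_nhds_iff.1 hV
    -- Distances are confined to `(-2, 2)`, so the same set serves every `r ≥ 2`.
    set V₂ := V₁ ∩ (Set.Ioo 0 (2 * Real.pi) ×ˢ Set.Ioo (-2) 2) with hV₂
    have hV₂o : IsOpen V₂ := hV₁o.inter (isOpen_Ioo.prod isOpen_Ioo)
    have hV₂ne : V₂.Nonempty := ⟨(α, 0), hαV, hα, by norm_num, by norm_num⟩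
    have hpos : 0 < volume V₂ := hV₂o.measure_pos volume hV₂ne
    have hfin : volume V₂ ≠ ⊤ := by
      refine ne_top_of_le_ne_top ?_ (measure_mono Set.inter_subset_right)
      rw [Measure.volume_eq_prod, Measure.prod_prod, Real.volume_Ioo, Real.volume_Ioo]
      exact ENNReal.mul_ne_top ENNReal.ofReal_ne_top ENNReal.ofReal_ne_top
    refine ⟨U, mem_nhdsWithin_of_mem_nhds hU, (volume V₂).toReal,
      ENNReal.toReal_pos hpos.ne' hfin, fun a ha r hr => ?_⟩
    rw [measureReal_def]
    refine ENNReal.toReal_mono (measure_ne_top _ _) ?_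
    rw [Measure.prod_restrict, ← Measure.volume_eq_prod,
      Measure.restrict_apply (isOpen_defectSet n a).measurableSet]
    refine measure_mono ?_
    rintro ⟨β, d⟩ ⟨h1, h2, h3⟩
    have hdef' : (a, (β, d)) ∈ {x : (ℕ → ℂ) × ℝ × ℝ | lineDefective n x.1 x.2.1 x.2.2} :=
      hUV (Set.mk_mem_prod ha (hV₁ h1))
    have h4 : -2 < d ∧ d < 2 := h3
    exact ⟨hdef', Set.mk_mem_prod ⟨h2.1, h2.2.le⟩
      ⟨by linarith [h4.1], by linarith [h4.2]⟩⟩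

/-! ### The length estimate -/

theorem centeredPoly_congr {n : ℕ} {a b : ℕ → ℂ} (h : ∀ k ∈ Finset.Icc 2 n, a k = b k) :
    centeredPoly n a = centeredPoly n b := by
  rw [centeredPoly, centeredPoly]
  congr 1
  exact Finset.sum_congr rfl fun k hk => by rw [h k hk]

theorem exists_lengthAtMost_of_unit {n : ℕ} (hn : 2 ≤ n) :
    ∃ c : ℝ, 0 < c ∧ ∀ a : ℕ → ℂ, (a n).im = 0 → (∀ k ∈ Finset.Icc 2 n, ‖a k‖ ≤ 1) →
      (∃ k ∈ Finset.Icc 2 n, ‖a k‖ = 1) → ∀ r : ℝ, 2 ≤ r →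
        LengthAtMost (reZeroSet (centeredPoly n a) ∩ Metric.ball 0 r) (2 * n * r - c) := by
  obtain ⟨c, hc, hdef⟩ := exists_pos_le_measure_defectSet hn
  -- The cap `1` covers the case where `ENNReal.ofReal` truncates to zero: then `0 ≤ 2nr - 1` is
  -- enough.
  refine ⟨min (c / 4) 1, by positivity, fun a han ha hex r hr => ?_⟩
  -- Irrelevant coefficients are set to zero, since compactness needs a bound on the whole sequence.
  set b : ℕ → ℂ := fun k => if k ∈ Finset.Icc 2 n then a k else 0 with hb
  have hab : ∀ k ∈ Finset.Icc 2 n, a k = b k := fun k hk => by simp only [hb, if_pos hk]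
  have hbu : b ∈ unitCoeffs n := by
    refine ⟨fun k => ?_, ?_, ?_⟩
    · by_cases hk : k ∈ Finset.Icc 2 n
      · rw [← hab k hk]
        exact ha k hk
      · simp only [hb, if_neg hk, norm_zero, zero_le_one]
    · rw [← hab n (Finset.mem_Icc.2 ⟨hn, le_rfl⟩)]
      exact han
    · obtain ⟨k, hk, hk1⟩ := hex
      exact ⟨k, hk, by rw [← hab k hk, hk1]⟩
  rw [centeredPoly_congr hab]
  have hV := hdef b hbu r hr
  have h4 := four_mul_hausdorffMeasure_reZeroSet_le hn (fun k _ => hbu.1 k) hr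
  rw [LengthAtMost, planeLength]
  set H := Measure.hausdorffMeasure 1 (reZeroSet (centeredPoly n b) ∩ Metric.ball 0 r)
  set V := ((volume.restrict (Set.Ioc 0 (2 * Real.pi))).prod
    (volume.restrict (Set.Ioo (-r) r))).real (defectSet n b)
  have hfin : H ≠ ⊤ := by
    intro htop
    rw [htop, ENNReal.mul_top (by norm_num)] at h4
    exact ENNReal.ofReal_ne_top (top_le_iff.1 h4)
  refine ⟨hfin, ?_⟩
  have h5 := ENNReal.toReal_mono ENNReal.ofReal_ne_top h4
  rw [ENNReal.toReal_mul, ENNReal.toReal_ofReal', ENNReal.toReal_ofNat] at h5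
  have hn2 : (2 : ℝ) ≤ n := by exact_mod_cast hn
  have hnr : 4 ≤ (n : ℝ) * r := by nlinarith
  have hm1 := min_le_left (c / 4) 1
  have hm2 := min_le_right (c / 4) 1
  rcases le_max_iff.1 h5 with h | h <;> nlinarith

/-! ### Reduction to unit coefficients by scaling -/

theorem eval_centeredPoly_scale {n : ℕ} (a : ℕ → ℂ) {A : ℝ} (hA : 0 < A) (z : ℂ) :
    (centeredPoly n a).eval (A * z) =
      ((A ^ n : ℝ) : ℂ) * (centeredPoly n fun k => a k / (A : ℂ) ^ k).eval z := by
  have hA' : (A : ℂ) ≠ 0 := by exact_mod_cast hA.ne'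
  rw [eval_centeredPoly, eval_centeredPoly, mul_add, Finset.mul_sum]
  push_cast
  congr 1
  · rw [mul_pow]
  · refine Finset.sum_congr rfl fun k hk => ?_
    rw [mul_pow, pow_sub₀ _ hA' (Finset.mem_Icc.1 hk).2]
    ring

theorem reZeroSet_inter_ball_scale {n : ℕ} (a : ℕ → ℂ) {A : ℝ} (hA : 0 < A) (r : ℝ) :
    reZeroSet (centeredPoly n a) ∩ Metric.ball 0 r =
      (fun z : ℂ => A • z) '' (reZeroSet (centeredPoly n fun k => a k / (A : ℂ) ^ k) ∩
        Metric.ball 0 (r / A)) := by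
  have hmem : ∀ z : ℂ, A • z ∈ reZeroSet (centeredPoly n a) ∩ Metric.ball 0 r ↔
      z ∈ reZeroSet (centeredPoly n fun k => a k / (A : ℂ) ^ k) ∩ Metric.ball 0 (r / A) := by
    intro z
    have h1 : A • z ∈ reZeroSet (centeredPoly n a) ↔
        z ∈ reZeroSet (centeredPoly n fun k => a k / (A : ℂ) ^ k) := by
      simp only [reZeroSet, Set.mem_ofPred_eq, Complex.real_smul]
      rw [eval_centeredPoly_scale a hA, Complex.re_ofReal_mul]
      exact mul_eq_zero_iff_left (pow_pos hA n).ne'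
    have h2 : A • z ∈ Metric.ball (0 : ℂ) r ↔ z ∈ Metric.ball (0 : ℂ) (r / A) := by
      rw [mem_ball_zero_iff, mem_ball_zero_iff, norm_smul, Real.norm_of_nonneg hA.le,
        lt_div_iff₀ hA, mul_comm]
    rw [Set.mem_inter_iff, Set.mem_inter_iff, h1, h2]
  ext z
  constructor
  · intro hz
    have hz' : A • (A⁻¹ • z) = z := smul_inv_smul₀ hA.ne' z
    exact ⟨A⁻¹ • z, (hmem _).1 (by rwa [hz']), hz'⟩
  · rintro ⟨w, hw, rfl⟩
    exact (hmem w).2 hw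

theorem LengthAtMost.image_smul {S : Set ℂ} {b A : ℝ} (h : LengthAtMost S b) (hA : 0 < A) :
    LengthAtMost ((fun z : ℂ => A • z) '' S) (A * b) := by
  have hm : planeLength ((fun z : ℂ => A • z) '' S) = ENNReal.ofReal A * planeLength S := by
    have h1 := Measure.hausdorffMeasure_smul₀ (d := 1) zero_le_one hA.ne' S
    rw [NNReal.rpow_one, ENNReal.smul_def, smul_eq_mul] at h1
    rw [planeLength, planeLength, Set.image_smul, h1]
    congr 1
    rw [ENNReal.ofReal, Real.nnnorm_of_nonneg hA.le, Real.toNNReal_of_nonneg hA.le]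
  rw [LengthAtMost, hm]
  refine ⟨ENNReal.mul_ne_top ENNReal.ofReal_ne_top h.1, ?_⟩
  rw [ENNReal.toReal_mul, ENNReal.toReal_ofReal hA.le]
  exact mul_le_mul_of_nonneg_left h.2 hA.le

theorem mainTheorem5 (n : ℕ) (hn : 2 ≤ n) :
    ∃ c : ℝ, 0 < c ∧
      (∀ a : ℕ → ℂ, (a n).im = 0 →
        IsGreatest ((fun k : ℕ => ‖a k‖) '' Set.Icc 2 n) 1 →
        ∀ r : ℝ, 2 ≤ r →
          LengthAtMost (reZeroSet (centeredPoly n a) ∩ Metric.ball 0 r) (2 * n * r - c)) ∧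
      (∀ (a : ℕ → ℂ) (A : ℝ), (a n).im = 0 → 0 < A →
        IsGreatest ((fun k : ℕ => ‖a k‖ ^ (1 / (k : ℝ))) '' Set.Icc 2 n) A →
        ∀ r : ℝ, 2 * A ≤ r →
          LengthAtMost (reZeroSet (centeredPoly n a) ∩ Metric.ball 0 r)
            (2 * n * r - c * A)) := by
  obtain ⟨c, hc, hlen⟩ := exists_lengthAtMost_of_unit hn
  refine ⟨c, hc, fun a han hmax r hr => ?_, fun a A han hA hmax r hr => ?_⟩
  · obtain ⟨⟨k, hk, hk1⟩, hub⟩ := hmax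
    refine hlen a han (fun j hj => hub ⟨j, Finset.mem_Icc.1 hj, rfl⟩)
      ⟨k, Finset.mem_Icc.2 hk, hk1⟩ r hr
  · have hpow : ∀ k ∈ Finset.Icc 2 n, (‖a k‖ ^ (1 / (k : ℝ))) ^ k = ‖a k‖ := by
      intro k hk
      rw [one_div]
      exact Real.rpow_inv_natCast_pow (norm_nonneg _)
        (by have := (Finset.mem_Icc.1 hk).1; omega)
    have hnorm : ∀ k, ‖a k / (A : ℂ) ^ k‖ = ‖a k‖ / A ^ k := by
      intro k
      rw [norm_div, norm_pow, Complex.norm_real, Real.norm_of_nonneg hA.le]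
    obtain ⟨⟨k, hk, hk1⟩, hub⟩ := hmax
    have h := hlen (fun k => a k / (A : ℂ) ^ k) (by
        rw [← Complex.ofReal_pow, Complex.div_ofReal_im, han, zero_div])
      (fun j hj => by
        rw [hnorm, div_le_one (pow_pos hA j), ← hpow j hj]
        exact pow_le_pow_left₀ (by positivity) (hub ⟨j, Finset.mem_Icc.1 hj, rfl⟩) j)
      ⟨k, Finset.mem_Icc.2 hk, by
        have hk1' : ‖a k‖ ^ (1 / (k : ℝ)) = A := hk1
        rw [hnorm, ← hpow k (Finset.mem_Icc.2 hk), hk1', div_self (pow_pos hA k).ne']⟩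
      (r / A) (by rwa [le_div_iff₀ hA])
    have h' := h.image_smul hA
    rw [← reZeroSet_inter_ball_scale a hA r] at h'
    convert h' using 1
    field_simp
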